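/- Let $F$ be a field and let $F\text{-VEC}$ be the category of $F$-vector spaces. For a vector space $V$ put $$P(V)=\prod_{n\ge 1}(V^{\otimes n})_{S(n)},$$ where $(V^{\otimes n})_{S(n)}$ is the space of coinvariants of $V^{\otimes n}$ under permutation of the factors; write $v_1\cdots v_n$ for the class of $v_1\otimes\cdots\otimes v_n$ and $t(n)$ for the degree $n$ component of $t\in P(V)$. A linear map $f$ induces $P(f)$, which is $v_1\cdots v_n\mapsto f(v_1)\cdots f(v_n)$ in each degree $n$. Then $P$ is a monad, the free reduced power series algebra monad: its unit $\eta_V:V\to P(V)$ sends $v$ to the series equal to $v$ in degree $1$ and to $0$ in all other degrees, and its multiplication $\mu_V:P(P(V))\to P(V)$ is given in degree $n$ by $$\mu_V(s)(n)=\sum_{k=1}^{n}m_k\big(s(k)\big)(n),$$ where $m_k$ is the linear map determined by $m_k(a_1\cdots a_k)(n)=\sum_{n_1+\cdots+n_k=n,\ n_j\ge1}a_1(n_1)\cdots a_k(n_k)$ for $a_1,\dots,a_k\in P(V)$. Hence $P$ is a comonad on $F\text{-VEC}^{op}$, which is a category with finite biproducts given by $V\times W$. Let $\partial_V:P(V)\to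 P(V\times V)$ be the linear map given in each degree $n$ by the sum of the partial derivatives, $$\partial_V(v_1\cdots v_n)=\sum_{j=1}^n (v_1,0)\cdots(v_{j-1},0)\,(0,v_j)\,(v_{j+1},0)\cdots(v_n,0),$$ and let $\varepsilon_V:P(V)\to V$, $\varepsilon_V(t)=t(1)$, be the projection onto degree $1$. Conventions: $\iota_0,\iota_1:A\to A\times A$ are the injections, $\nabla_A=\pi_0+\pi_1:A\times A\to A$, $\ell_A=\iota_0\times\iota_1$ and $c_A=\langle\pi_0\times\pi_0,\pi_1\times\pi_1\rangle$. A *differential combinator transformation* on a comonad $(!,\delta,\epsilon)$ on a category with finite biproducts is a natural transformation $\partial_A:\,!(A\times A)\to\, !A$ such that 1. $\partial_A\circ !(\iota_0)=0$; 2. $\partial_A\circ !(1\times\nabla_A)=\partial_A\circ\big(!(1\times\pi_0)+!(1\times\pi_1)\big)$; 3. $\epsilon_A\circ\partial_A=\pi_1\circ\epsilon_{A\times A}$; 4. $\delta_A\circ\partial_A=\partial_{!A}\circ !\big(\langle !(\pi_0),\partial_A\rangle\big)\circ\delta_{A\times A}$; 5. $\partial_A\circ\partial_{A\times A}\circ !(\ell_A)=\partial_A$;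 6. $\partial_A\circ\partial_{A\times A}\circ !(c_A)=\partial_A\circ\partial_{A\times A}$. The comonad together with $\partial$ is then called a *Cartesian differential comonad*. A *$D$-linear unit* for it is a natural transformation $\eta_A:A\to\,!A$ with $\epsilon_A\circ\eta_A=1$ and $\eta_A\circ\epsilon_A=\partial_A\circ !(\iota_1)$. A *Cartesian left additive category* is a category with finite products whose hom-sets are commutative monoids such that $(f+g)\circ x=f\circ x+g\circ x$ and $0\circ x=0$, and whose projections are additive, i.e. $\pi_i\circ(x+y)=\pi_i\circ x+\pi_i\circ y$ and $\pi_i\circ 0=0$. A *Cartesian differential category* is a Cartesian left additive category with an operator $D$ taking $f:A\to B$ to $D[f]:A\times A\to B$ such that 1. $D[f+g]=D[f]+D[g]$ and $D[0]=0$; 2. $D[f]\circ(1\times\nabla_A)=D[f]\circ(1\times\pi_0)+D[f]\circ(1\times\pi_1)$ and $D[f]\circ\iota_0=0$; 3. $D[1_A]=\pi_1$ and $D[\pi_i]=\pi_i\circ\pi_1$ for $i=0,1$; 4. $D[\langle f,g\rangle]=\langle D[f],D[g]\rangle$; 5. $D[g\circ f]=D[g]\circ\langle f\circ\pi_0,D[f]\rangle$;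 6. $D[D[f]]\circ\ell_A=D[f]$; 7. $D[D[f]]\circ c_A=D[D[f]]$. A map $f$ is *$D$-linear* if $D[f]=f\circ\pi_1$; the $D$-linear maps form a subcategory containing all objects. **Statement.** The maps $\partial_V$, regarded as maps $P(V\times V)\to P(V)$ of $F\text{-VEC}^{op}$, form a differential combinator transformation, so that $P$ with $\partial$ is a Cartesian differential comonad on $F\text{-VEC}^{op}$, and the maps $\varepsilon_V$ form a $D$-linear unit for it. The coKleisli category $F\text{-VEC}^{op}_P$, with its Cartesian left additive structure inherited from $F\text{-VEC}^{op}$, is a Cartesian differential category with differential combinator $D[f]=f\circ\partial_A$ (composition in $F\text{-VEC}^{op}$, for a coKleisli map $f$ from $A$ to $B$). The canonical functor $F\text{-VEC}^{op}\to F\text{-VEC}^{op}_P$, which is the identity on objects and precomposes a map with the comonad counit, takes values in $D$-linear maps and is an isomorphism of categories from $F\text{-VEC}^{op}$ onto the subcategory of $D$-linear maps of $F\text{-VEC}^{op}_P$. -/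

import Mathlib

open CategoryTheory Opposite
open scoped TensorProduct

universe u v w

namespace CartDiff

/-- A Cartesian left additive category (with chosen finite products): every hom-set is a
commutative monoid, precomposition is additive, there are chosen finite products, and the
projections are additive maps. (Composition is written in diagrammatic order.) -/
class CartesianLeftAdditive (X : Type u) [Category.{v} X] where
  /-- Every hom-set is a commutative monoid. -/
  homAdd (A B : X) : AddCommMonoid (A ⟶ B)
  comp_add {A B C : X} (x : A ⟶ B) (f g : B ⟶ C) : x ≫ (f + g) = x ≫ f + x ≫ g
  comp_zero {A B C : X} (x : A ⟶ B) : x ≫ (0 : B ⟶ C) = 0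
  /-- The chosen terminal object. -/
  top : X
  /-- The unique map to the terminal object. -/
  toTop (A : X) : A ⟶ top
  toTop_unique {A : X} (f : A ⟶ top) : f = toTop A
  /-- The chosen binary product. -/
  prodObj (A B : X) : X
  /-- The first projection. -/
  fst (A B : X) : prodObj A B ⟶ A
  /-- The second projection. -/
  snd (A B : X) : prodObj A B ⟶ B
  /-- The pairing of two maps. -/
  pair {A B C : X} (f : C ⟶ A) (g : C ⟶ B) : C ⟶ prodObj A B
  pair_fst {A B C : X} (f : C ⟶ A) (g : C ⟶ B) : pair f g ≫ fst A B = f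
  pair_snd {A B C : X} (f : C ⟶ A) (g : C ⟶ B) : pair f g ≫ snd A B = g
  pair_unique {A B C : X} (f : C ⟶ A) (g : C ⟶ B) (h : C ⟶ prodObj A B)
    (hf : h ≫ fst A B = f) (hg : h ≫ snd A B = g) : h = pair f g
  add_fst {A B C : X} (x y : C ⟶ prodObj A B) : (x + y) ≫ fst A B = x ≫ fst A B + y ≫ fst A B
  zero_fst {A B C : X} : (0 : C ⟶ prodObj A B) ≫ fst A B = 0
  add_snd {A B C : X} (x y : C ⟶ prodObj A B) : (x + y) ≫ snd A B = x ≫ snd A B + y ≫ snd A B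
  zero_snd {A B C : X} : (0 : C ⟶ prodObj A B) ≫ snd A B = 0

attribute [reducible, instance] CartesianLeftAdditive.homAdd

open CartesianLeftAdditive

section Maps

variable {X : Type u} [Category.{v} X] [CartesianLeftAdditive X]

/-- A map is additive if postcomposition with it preserves sums and zero. -/
def IsAdditive {A B : X} (f : A ⟶ B) : Prop :=
  (∀ {C : X} (x y : C ⟶ A), (x + y) ≫ f = x ≫ f + y ≫ f) ∧
    ∀ {C : X}, (0 : C ⟶ A) ≫ f = 0

/-- The product `f × g` of two maps. -/
def prodMap {A B C D : X} (f : A ⟶ C) (g : B ⟶ D) : prodObj A B ⟶ prodObj C D :=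
  pair (fst A B ≫ f) (snd A B ≫ g)

/-- The injection `ι₀ = ⟨1, 0⟩`. -/
def inj₀ (A B : X) : A ⟶ prodObj A B := pair (𝟙 A) 0

/-- The injection `ι₁ = ⟨0, 1⟩`. -/
def inj₁ (A B : X) : B ⟶ prodObj A B := pair 0 (𝟙 B)

/-- The sum map `∇ = π₀ + π₁`. -/
def nabla (A : X) : prodObj A A ⟶ A := fst A A + snd A A

/-- The lifting map `ℓ = ι₀ × ι₁`. -/
def lifting (A : X) : prodObj A A ⟶ prodObj (prodObj A A) (prodObj A A) :=
  prodMap (inj₀ A A) (inj₁ A A)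

/-- The interchange map `c = ⟨π₀ × π₀, π₁ × π₁⟩`. -/
def interchange (A : X) : prodObj (prodObj A A) (prodObj A A) ⟶ prodObj (prodObj A A) (prodObj A A) :=
  pair (prodMap (fst A A) (fst A A)) (prodMap (snd A A) (snd A A))

end Maps

/-- A category with (chosen) finite biproducts, i.e. a Cartesian left additive category in which
every map is additive. -/
class FiniteBiproducts (X : Type u) [Category.{v} X] extends CartesianLeftAdditive X where
  isAdditive {A B : X} (f : A ⟶ B) : IsAdditive f

/-- A differential combinator on a Cartesian left additive category; a Cartesian differential
category is a Cartesian left additive category equipped with one. -/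
structure DifferentialCombinator (X : Type u) [Category.{v} X] [CartesianLeftAdditive X] where
  /-- The derivative of a map. -/
  deriv {A B : X} (f : A ⟶ B) : prodObj A A ⟶ B
  deriv_add {A B : X} (f g : A ⟶ B) : deriv (f + g) = deriv f + deriv g
  deriv_zero {A B : X} : deriv (0 : A ⟶ B) = 0
  nabla_deriv {A B : X} (f : A ⟶ B) :
    prodMap (𝟙 A) (nabla A) ≫ deriv f =
      prodMap (𝟙 A) (fst A A) ≫ deriv f + prodMap (𝟙 A) (snd A A) ≫ deriv f
  inj₀_deriv {A B : X} (f : A ⟶ B) : inj₀ A A ≫ deriv f = 0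
  deriv_id (A : X) : deriv (𝟙 A) = snd A A
  deriv_fst (A B : X) : deriv (fst A B) = snd (prodObj A B) (prodObj A B) ≫ fst A B
  deriv_snd (A B : X) : deriv (snd A B) = snd (prodObj A B) (prodObj A B) ≫ snd A B
  deriv_pair {A B C : X} (f : C ⟶ A) (g : C ⟶ B) :
    deriv (pair f g) = pair (deriv f) (deriv g)
  deriv_comp {A B C : X} (f : A ⟶ B) (g : B ⟶ C) :
    deriv (f ≫ g) = pair (fst A A ≫ f) (deriv f) ≫ deriv g
  lifting_deriv {A B : X} (f : A ⟶ B) : lifting A ≫ deriv (deriv f) = deriv f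
  interchange_deriv {A B : X} (f : A ⟶ B) :
    interchange A ≫ deriv (deriv f) = deriv (deriv f)

namespace DifferentialCombinator

variable {X : Type u} [Category.{v} X] [CartesianLeftAdditive X]

/-- A map `f` is `D`-linear if `D[f] = f ∘ π₁`. -/
def IsLinear (D : DifferentialCombinator X) : MorphismProperty X :=
  fun A _ f => D.deriv f = snd A A ≫ f

instance isMultiplicative_isLinear (D : DifferentialCombinator X) : D.IsLinear.IsMultiplicative where
  id_mem A := by simp [IsLinear, D.deriv_id]
  comp_mem {A B C} f g hf hg := by
    simp only [IsLinear] at hf hg ⊢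
    rw [D.deriv_comp, hg, ← Category.assoc, pair_snd, hf, Category.assoc]

/-- The category of all objects and the `D`-linear maps between them. -/
abbrev Lin (D : DifferentialCombinator X) := WideSubcategory D.IsLinear

end DifferentialCombinator

/-- The coKleisli category of a comonad on a Cartesian left additive category is again Cartesian
left additive: sums, zero, pairings, the products of objects and the terminal object are those of
the base category, and the projections are `ε ≫ π₀` and `ε ≫ π₁`. -/
instance cokleisli {X : Type u} [Category.{v} X] [CartesianLeftAdditive X] (W : Comonad X) :
    CartesianLeftAdditive (Cokleisli W) where
  homAdd A B :=
    { add f g := ⟨f.of + g.of⟩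
      zero := ⟨(0 : W.obj A.of ⟶ B.of)⟩
      nsmul n f := ⟨n • f.of⟩
      nsmul_zero _ := Cokleisli.hom_ext _ (zero_nsmul _)
      nsmul_succ _ _ := Cokleisli.hom_ext _ (succ_nsmul _ _)
      add_assoc _ _ _ := Cokleisli.hom_ext _ (add_assoc _ _ _)
      zero_add _ := Cokleisli.hom_ext _ (zero_add _)
      add_zero _ := Cokleisli.hom_ext _ (add_zero _)
      add_comm _ _ := Cokleisli.hom_ext _ (add_comm _ _) }
  comp_add x f g := Cokleisli.hom_ext _ <| by
    change W.δ.app _ ≫ W.map x.of ≫ (f.of + g.of) = _ + _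
    rw [comp_add, comp_add]; rfl
  comp_zero x := Cokleisli.hom_ext _ <| by
    change W.δ.app _ ≫ W.map x.of ≫ 0 = 0
    rw [comp_zero, comp_zero]
  top := Cokleisli.mk W top
  toTop A := ⟨toTop _⟩
  toTop_unique f := Cokleisli.hom_ext _ (toTop_unique _)
  prodObj A B := Cokleisli.mk W (prodObj A.of B.of)
  fst A B := ⟨W.ε.app (prodObj A.of B.of) ≫ fst A.of B.of⟩
  snd A B := ⟨W.ε.app (prodObj A.of B.of) ≫ snd A.of B.of⟩
  pair f g := ⟨pair f.of g.of⟩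
  pair_fst f g := Cokleisli.hom_ext _ <| by
    change W.δ.app _ ≫ W.map (pair f.of g.of) ≫ W.ε.app _ ≫ fst _ _ = _
    rw [Comonad.counit_naturality_assoc, Comonad.left_counit_assoc, pair_fst]
  pair_snd f g := Cokleisli.hom_ext _ <| by
    change W.δ.app _ ≫ W.map (pair f.of g.of) ≫ W.ε.app _ ≫ snd _ _ = _
    rw [Comonad.counit_naturality_assoc, Comonad.left_counit_assoc, pair_snd]
  pair_unique f g h hf hg := Cokleisli.hom_ext _ <| by
    subst hf hg
    apply pair_unique
    · change _ = W.δ.app _ ≫ W.map h.of ≫ W.ε.app _ ≫ fst _ _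
      rw [Comonad.counit_naturality_assoc, Comonad.left_counit_assoc]
    · change _ = W.δ.app _ ≫ W.map h.of ≫ W.ε.app _ ≫ snd _ _
      rw [Comonad.counit_naturality_assoc, Comonad.left_counit_assoc]
  add_fst x y := Cokleisli.hom_ext _ <| by
    change W.δ.app _ ≫ W.map (x.of + y.of) ≫ W.ε.app _ ≫ fst _ _ =
      W.δ.app _ ≫ W.map x.of ≫ W.ε.app _ ≫ fst _ _ +
        W.δ.app _ ≫ W.map y.of ≫ W.ε.app _ ≫ fst _ _
    simp only [Comonad.counit_naturality_assoc, Comonad.left_counit_assoc]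
    exact add_fst _ _
  zero_fst {A B C} := Cokleisli.hom_ext _ <| by
    change W.δ.app _ ≫ W.map (0 : W.obj C.of ⟶ prodObj A.of B.of) ≫ W.ε.app _ ≫ fst _ _ = 0
    rw [Comonad.counit_naturality_assoc, Comonad.left_counit_assoc]
    exact zero_fst
  add_snd x y := Cokleisli.hom_ext _ <| by
    change W.δ.app _ ≫ W.map (x.of + y.of) ≫ W.ε.app _ ≫ snd _ _ =
      W.δ.app _ ≫ W.map x.of ≫ W.ε.app _ ≫ snd _ _ +
        W.δ.app _ ≫ W.map y.of ≫ W.ε.app _ ≫ snd _ _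
    simp only [Comonad.counit_naturality_assoc, Comonad.left_counit_assoc]
    exact add_snd _ _
  zero_snd {A B C} := Cokleisli.hom_ext _ <| by
    change W.δ.app _ ≫ W.map (0 : W.obj C.of ⟶ prodObj A.of B.of) ≫ W.ε.app _ ≫ snd _ _ = 0
    rw [Comonad.counit_naturality_assoc, Comonad.left_counit_assoc]
    exact zero_snd

section Comonad

variable {X : Type u} [Category.{v} X] [FiniteBiproducts X]

/-- A differential combinator transformation `∂_A : !(A × A) ⟶ !A` on a comonad on a category with
finite biproducts; a Cartesian differential comonad is a comonad equipped with one. -/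
structure DifferentialCombinatorTransformation (W : Comonad X) where
  /-- The components of the transformation. -/
  app (A : X) : W.obj (prodObj A A) ⟶ W.obj A
  naturality {A B : X} (f : A ⟶ B) : W.map (prodMap f f) ≫ app B = app A ≫ W.map f
  zero_rule (A : X) : W.map (inj₀ A A) ≫ app A = 0
  additive_rule (A : X) :
    W.map (prodMap (𝟙 A) (nabla A)) ≫ app A =
      (W.map (prodMap (𝟙 A) (fst A A)) + W.map (prodMap (𝟙 A) (snd A A))) ≫ app A
  linear_rule (A : X) : app A ≫ W.ε.app A = W.ε.app (prodObj A A) ≫ snd A A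
  chain_rule (A : X) :
    app A ≫ W.δ.app A =
      W.δ.app (prodObj A A) ≫ W.map (pair (W.map (fst A A)) (app A)) ≫ app (W.obj A)
  lift_rule (A : X) : W.map (lifting A) ≫ app (prodObj A A) ≫ app A = app A
  symmetry_rule (A : X) :
    W.map (interchange A) ≫ app (prodObj A A) ≫ app A = app (prodObj A A) ≫ app A

/-- A `D`-linear unit `η_A : A ⟶ !A` of a Cartesian differential comonad. -/
structure DLinearUnit {W : Comonad X} (d : DifferentialCombinatorTransformation W) where
  /-- The components of the unit. -/
  app (A : X) : A ⟶ W.obj A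
  naturality {A B : X} (f : A ⟶ B) : f ≫ app B = app A ≫ W.map f
  linear (A : X) : app A ≫ W.ε.app A = 𝟙 A
  linearization (A : X) : W.ε.app A ≫ app A = W.map (inj₁ A A) ≫ d.app A

end Comonad

/-- The comonad on the opposite category given by a monad. -/
def opComonad {C : Type u} [Category.{v} C] (T : Monad C) : Comonad Cᵒᵖ where
  toFunctor := T.toFunctor.op
  ε := { app A := (T.η.app A.unop).op
         naturality _ _ f := Quiver.Hom.unop_inj (T.η.naturality f.unop).symm }
  δ := { app A := (T.μ.app A.unop).op
         naturality _ _ f := Quiver.Hom.unop_inj (T.μ.naturality f.unop).symm }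
  coassoc A := Quiver.Hom.unop_inj (T.assoc A.unop)
  left_counit A := Quiver.Hom.unop_inj (T.left_unit A.unop)
  right_counit A := Quiver.Hom.unop_inj (T.right_unit A.unop)

/-- The opposite of the category of `F`-modules has finite biproducts, given by the usual cartesian
product `V × W` of modules: the projections of the opposite category are the two inclusions. -/
instance moduleCatOp (F : Type u) [Ring F] : FiniteBiproducts (ModuleCat.{v} F)ᵒᵖ where
  homAdd A B := inferInstance
  comp_add x f g := Preadditive.comp_add _ _ _ _ _ _
  comp_zero x := Limits.comp_zero
  top := op (ModuleCat.of F PUnit.{v + 1})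
  toTop A := (ModuleCat.ofHom (0 : PUnit.{v + 1} →ₗ[F] A.unop)).op
  toTop_unique {A} f := Quiver.Hom.unop_inj <| ModuleCat.hom_ext <| LinearMap.ext fun x => by
    rw [Subsingleton.elim x 0]; simp
  prodObj A B := op (ModuleCat.of F (A.unop × B.unop))
  fst A B := (ModuleCat.ofHom (LinearMap.inl F A.unop B.unop)).op
  snd A B := (ModuleCat.ofHom (LinearMap.inr F A.unop B.unop)).op
  pair f g := (ModuleCat.ofHom (LinearMap.coprod f.unop.hom g.unop.hom)).op
  pair_fst f g := Quiver.Hom.unop_inj <| ModuleCat.hom_ext <| LinearMap.coprod_inl _ _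
  pair_snd f g := Quiver.Hom.unop_inj <| ModuleCat.hom_ext <| LinearMap.coprod_inr _ _
  pair_unique f g h hf hg := by
    subst hf hg
    refine Quiver.Hom.unop_inj <| ModuleCat.hom_ext <| LinearMap.prod_ext ?_ ?_
    · exact (LinearMap.coprod_inl _ _).symm
    · exact (LinearMap.coprod_inr _ _).symm
  add_fst x y := Preadditive.add_comp _ _ _ _ _ _
  zero_fst := Limits.zero_comp
  add_snd x y := Preadditive.add_comp _ _ _ _ _ _
  zero_snd := Limits.zero_comp
  isAdditive f := ⟨fun x y => Preadditive.add_comp _ _ _ _ _ _, Limits.zero_comp⟩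

end CartDiff

namespace ReducedPowerSeries

open PiTensorProduct

section SymmetrizedTensors

variable (F : Type u) [CommRing F] (V : Type v) [AddCommGroup V] [Module F V]

/-- The action of the symmetric group on `V^{⊗n}` by permutation of the factors. -/
noncomputable def permRep (n : ℕ) : Representation F (Equiv.Perm (Fin n)) (⨂[F]^n V) where
  toFun σ := (reindex F (fun _ : Fin n => V) σ).toLinearMap
  map_one' := by
    ext v
    simp [Equiv.Perm.one_def]
  map_mul' σ τ := by
    ext v
    simp [Equiv.Perm.mul_def, reindex_tprod]
    rfl

/-- The space `(V^{⊗n})_{S(n)}` of symmetrized `n`-tensors: the coinvariants of `V^{⊗n}` under the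
action of the symmetric group. -/
abbrev SymT (n : ℕ) : Type (max u v) := (permRep F V n).Coinvariants

variable {F V}

namespace SymT

/-- The class `v_1 ⋯ v_n` of the tensor `v_1 ⊗ ⋯ ⊗ v_n`, as a multilinear map. -/
noncomputable def mono (n : ℕ) : MultilinearMap F (fun _ : Fin n => V) (SymT F V n) :=
  (Representation.Coinvariants.mk (permRep F V n)).compMultilinearMap (tprod F)

lemma mono_perm {n : ℕ} (σ : Equiv.Perm (Fin n)) (v : Fin n → V) :
    mono (F := F) n (fun i => v (σ i)) = mono n v := by
  have := Representation.Coinvariants.mk_self_apply (permRep F V n) σ⁻¹ (tprod F v)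
  rw [← show mono (F := F) n v = Representation.Coinvariants.mk _ (tprod F v) from rfl] at this
  rw [← this]
  simp only [permRep, mono, MonoidHom.coe_mk, OneHom.coe_mk,
    LinearEquiv.coe_coe, reindex_tprod]
  rfl

lemma mono_equiv {m n : ℕ} (h : m = n) (e : Fin m ≃ Fin n) (v : Fin n → V) :
    mono (F := F) n v = mono n (fun i => v (e (Fin.cast h.symm i))) := by
  subst h
  exact (mono_perm e v).symm

/-- Linear maps on symmetrized tensors are determined by their values on the classes
`v_1 ⋯ v_n`. -/
lemma hom_ext {n : ℕ} {W : Type w} [AddCommGroup W] [Module F W] {f g : SymT F V n →ₗ[F] W}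
    (h : ∀ v, f (mono n v) = g (mono n v)) : f = g :=
  Representation.Coinvariants.hom_ext (PiTensorProduct.ext (MultilinearMap.ext h))

/-- A symmetric multilinear map factors through the symmetrized tensors. -/
noncomputable def lift {n : ℕ} {W : Type w} [AddCommGroup W] [Module F W]
    (f : MultilinearMap F (fun _ : Fin n => V) W)
    (hf : ∀ (σ : Equiv.Perm (Fin n)) v, f (fun i => v (σ i)) = f v) : SymT F V n →ₗ[F] W :=
  Representation.Coinvariants.lift _ (PiTensorProduct.lift f) fun σ => by
    ext v
    simpa [permRep, reindex_tprod] using hf σ.symm v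

@[simp]
lemma lift_mono {n : ℕ} {W : Type w} [AddCommGroup W] [Module F W]
    (f : MultilinearMap F (fun _ : Fin n => V) W)
    (hf : ∀ (σ : Equiv.Perm (Fin n)) v, f (fun i => v (σ i)) = f v) (v : Fin n → V) :
    lift f hf (mono n v) = f v :=
  PiTensorProduct.lift.tprod _

/-- The concatenation of tensors, with values in symmetrized tensors. -/
noncomputable def concatAux {i j n : ℕ} (h : i + j = n) :
    ⨂[F]^i V →ₗ[F] ⨂[F]^j V →ₗ[F] SymT F V n :=
  (TensorProduct.mk F (⨂[F]^i V) (⨂[F]^j V)).compr₂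
    (Representation.Coinvariants.mk (permRep F V n) ∘ₗ (TensorPower.cast F V h).toLinearMap ∘ₗ
      (TensorPower.mulEquiv (R := F) (M := V) (n := i) (m := j)).toLinearMap)

lemma concatAux_tprod {i j n : ℕ} (h : i + j = n) (v : Fin i → V) (w : Fin j → V) :
    concatAux (F := F) h (tprod F v) (tprod F w) =
      mono n (fun k => Fin.append v w (Fin.cast h.symm k)) := by
  have : TensorPower.mulEquiv (R := F) (tprod F v ⊗ₜ[F] tprod F w) = tprod F (Fin.append v w) :=
    TensorPower.tprod_mul_tprod F v w
  simp only [concatAux, LinearMap.compr₂_apply, TensorProduct.mk_apply, LinearMap.comp_apply,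
    LinearEquiv.coe_coe, this, TensorPower.cast_tprod, mono, LinearMap.compMultilinearMap_apply]
  rfl

/-- The concatenation product
`(V^{⊗i})_{S(i)} ⊗ (V^{⊗j})_{S(j)} → (V^{⊗n})_{S(n)}`, where `i + j = n`. -/
noncomputable def concat {i j n : ℕ} (h : i + j = n) :
    SymT F V i →ₗ[F] SymT F V j →ₗ[F] SymT F V n :=
  LinearMap.flip <| Representation.Coinvariants.lift _
    (LinearMap.flip <| Representation.Coinvariants.lift _ (concatAux h) fun σ => by
      ext v w
      simp only [permRep, MonoidHom.coe_mk, OneHom.coe_mk, LinearMap.compMultilinearMap_apply,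
        LinearMap.comp_apply, LinearEquiv.coe_coe, reindex_tprod, concatAux_tprod]
      subst h
      refine Eq.trans ?_ (mono_perm (finSumFinEquiv.symm.trans
        ((Equiv.sumCongr σ.symm (Equiv.refl _)).trans finSumFinEquiv)) _)
      congr 1
      funext k
      refine Fin.addCases (fun a => ?_) (fun b => ?_) k <;> simp) fun σ => by
      ext w v
      change concatAux h (tprod F v) (reindex F (fun _ => V) σ (tprod F w)) =
        concatAux h (tprod F v) (tprod F w)
      simp only [reindex_tprod, concatAux_tprod]
      subst h
      refine Eq.trans ?_ (mono_perm (finSumFinEquiv.symm.trans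
        ((Equiv.sumCongr (Equiv.refl _) σ.symm).trans finSumFinEquiv)) _)
      congr 1
      funext k
      refine Fin.addCases (fun a => ?_) (fun b => ?_) k <;> simp

lemma concat_mono {i j n : ℕ} (h : i + j = n) (v : Fin i → V) (w : Fin j → V) :
    concat (F := F) h (mono i v) (mono j w) =
      mono n (fun k => Fin.append v w (Fin.cast h.symm k)) :=
  concatAux_tprod h v w

lemma concat_comm {i j n : ℕ} (h : i + j = n) (x : SymT F V i) (y : SymT F V j) :
    concat h x y = concat (by omega) y x := by
  suffices H : concat (F := F) (V := V) h = (concat (by omega)).flip by rw [H]; rfl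
  refine hom_ext fun v => hom_ext fun w => ?_
  rw [LinearMap.flip_apply, concat_mono, concat_mono]
  subst h
  rw [mono_equiv rfl ((finCongr (Nat.add_comm i j)).trans
    (finAddFlip (m := j) (n := i)))]
  congr 1
  funext k
  obtain ⟨k, rfl⟩ := (finCongr (Nat.add_comm j i)).surjective k
  refine Fin.addCases (fun a => ?_) (fun b => ?_) k <;> simp

lemma concat_assoc {i j k l m n : ℕ} (hl : i + j = l) (hm : j + k = m) (h₁ : l + k = n)
    (h₂ : i + m = n) (x : SymT F V i) (y : SymT F V j) (z : SymT F V k) :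
    concat h₁ (concat hl x y) z = concat h₂ x (concat hm y z) := by
  suffices H : (concat (F := F) (V := V) h₁) ∘ₗ (concat hl x) =
      (LinearMap.llcomp F _ _ _ (concat h₂ x)) ∘ₗ (concat hm) by
    exact congr($H y z)
  refine hom_ext fun v => hom_ext fun w => ?_
  suffices H : (concat (F := F) (V := V) h₁).flip (mono k w) ∘ₗ (concat hl).flip (mono j v) =
      (concat h₂).flip (concat hm (mono j v) (mono k w)) from congr($H x)
  refine hom_ext fun u => ?_
  simp only [LinearMap.comp_apply, LinearMap.flip_apply, concat_mono]
  subst hl hm h₁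
  congr 1
  simp only [Fin.cast_eq_self]
  funext t
  have := congr_fun (Fin.append_assoc u v w) t
  exact this

/-- The functorial action of a linear map on symmetrized tensors:
`v_1 ⋯ v_n ↦ f(v_1) ⋯ f(v_n)`. -/
noncomputable def map {W : Type w} [AddCommGroup W] [Module F W] (f : V →ₗ[F] W) (n : ℕ) :
    SymT F V n →ₗ[F] SymT F W n :=
  lift ((mono n).compLinearMap fun _ => f) fun σ v => mono_perm σ fun i => f (v i)

lemma map_mono {W : Type w} [AddCommGroup W] [Module F W] (f : V →ₗ[F] W) (n : ℕ)
    (v : Fin n → V) : map f n (mono n v) = mono n (fun i => f (v i)) :=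
  lift_mono _ _ _

/-- The sum of partial derivatives of a monomial:
`v_1 ⋯ v_n ↦ ∑ j, (∏ k ≠ j, (v_k, 0)) (0, v_j)`. As the factors commute, the factor `(0, v_j)` may
be left in the `j`-th place. -/
noncomputable def deriv (n : ℕ) : SymT F V n →ₗ[F] SymT F (V × V) n :=
  lift (∑ j : Fin n, (mono n).compLinearMap fun k =>
      if k = j then LinearMap.inr F V V else LinearMap.inl F V V) fun σ v => by
    simp only [_root_.sum_apply, MultilinearMap.compLinearMap_apply]
    refine Fintype.sum_equiv σ _ _ fun j => ?_
    refine Eq.trans ?_ (mono_perm σ _)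
    congr 1
    funext k
    simp only [EmbeddingLike.apply_eq_iff_eq]

lemma deriv_mono (n : ℕ) (v : Fin n → V) :
    deriv (F := F) n (mono n v) =
      ∑ j, mono n (fun k => if k = j then ((0 : V), v k) else (v k, (0 : V))) := by
  rw [deriv, lift_mono]
  simp only [_root_.sum_apply, MultilinearMap.compLinearMap_apply]
  refine Finset.sum_congr rfl fun j _ => ?_
  congr 1
  funext k
  split_ifs <;> simp

end SymT

end SymmetrizedTensors

section Series

variable (F : Type u) [CommRing F] (V : Type v) [AddCommGroup V] [Module F V]

/-- The underlying module of the free reduced power series algebra: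
`P(V) = ∏_{n ≥ 1} (V^{⊗n})_{S(n)}`. -/
abbrev Pow : Type (max u v) := ∀ n : ℕ+, SymT F V n

/-- The algebra `∏_{n ≥ 0} (V^{⊗n})_{S(n)}` of all power series, constant terms included. It only
serves to multiply finitely many reduced power series. -/
def Series : Type (max u v) := ∀ n : ℕ, SymT F V n

noncomputable instance : AddCommGroup (Series F V) :=
  inferInstanceAs (AddCommGroup (∀ n : ℕ, SymT F V n))

noncomputable instance : Module F (Series F V) :=
  inferInstanceAs (Module F (∀ n : ℕ, SymT F V n))

variable {F V}

/-- The concatenation product of homogeneous elements of degrees `i` and `j`, as an element of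
degree `n`; it is only used for `i + j = n`. -/
noncomputable def concatTo (i j n : ℕ) : SymT F V i →ₗ[F] SymT F V j →ₗ[F] SymT F V n :=
  if h : i + j = n then SymT.concat h else 0

lemma concatTo_of_eq {i j n : ℕ} (h : i + j = n) :
    concatTo (F := F) (V := V) i j n = SymT.concat h :=
  dif_pos h

namespace Series

/-- The power series with given homogeneous parts. -/
noncomputable def mk (f : ∀ n : ℕ, SymT F V n) : Series F V := f

/-- The homogeneous part of degree `n`. -/
noncomputable def coeff (n : ℕ) : Series F V →ₗ[F] SymT F V n :=
  LinearMap.proj (φ := fun n : ℕ => SymT F V n) n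

@[simp] lemma coeff_mk (f : ∀ n : ℕ, SymT F V n) (n : ℕ) : coeff n (mk f) = f n := rfl

lemma ext {f g : Series F V} (h : ∀ n, coeff n f = coeff n g) : f = g := funext h

/-- The Cauchy product. -/
noncomputable instance : Mul (Series F V) where
  mul f g := mk fun n => ∑ p ∈ Finset.HasAntidiagonal.antidiagonal n,
    concatTo p.1 p.2 n (coeff p.1 f) (coeff p.2 g)

lemma coeff_mul (f g : Series F V) (n : ℕ) :
    coeff n (f * g) = ∑ p ∈ Finset.HasAntidiagonal.antidiagonal n,
      concatTo p.1 p.2 n (coeff p.1 f) (coeff p.2 g) := rfl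

noncomputable instance : One (Series F V) where
  one := mk fun n => if h : n = 0 then SymT.mono n (fun i => (Fin.cast h i).elim0) else 0

lemma coeff_zero_one : coeff 0 (1 : Series F V) = SymT.mono 0 (fun i => i.elim0) := rfl

lemma coeff_one_of_ne {n : ℕ} (h : n ≠ 0) : coeff n (1 : Series F V) = 0 := dif_neg h

protected lemma mul_comm (f g : Series F V) : f * g = g * f := by
  refine ext fun n => ?_
  rw [coeff_mul, coeff_mul, ← Finset.Nat.sum_antidiagonal_swap]
  refine Finset.sum_congr rfl fun p hp => ?_
  rw [Finset.HasAntidiagonal.mem_antidiagonal] at hp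
  rw [concatTo_of_eq (by simpa [add_comm] using hp), concatTo_of_eq hp, SymT.concat_comm]
  rfl

protected lemma one_mul (f : Series F V) : 1 * f = f := by
  refine ext fun n => ?_
  rw [coeff_mul, Finset.sum_eq_single (0, n)]
  · rw [concatTo_of_eq (zero_add n), coeff_zero_one]
    suffices H : SymT.concat (F := F) (V := V) (zero_add n) (SymT.mono 0 fun i => i.elim0) =
      LinearMap.id from congr($H (coeff n f))
    refine SymT.hom_ext fun v => ?_
    rw [SymT.concat_mono]
    simp only [LinearMap.id_apply]
    congr 1
    funext k
    have : Fin.cast (zero_add n).symm k = Fin.natAdd 0 k := by ext; simp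
    rw [this, Fin.append_right]
  · rintro ⟨i, j⟩ hp hne
    rw [Finset.HasAntidiagonal.mem_antidiagonal] at hp
    have : i ≠ 0 := by
      rintro rfl
      simp only [zero_add] at hp
      exact hne (by rw [hp])
    simp only [coeff_one_of_ne this, map_zero, LinearMap.zero_apply]
  · intro h
    simp at h

protected lemma mul_assoc (f g h : Series F V) : f * g * h = f * (g * h) := by
  refine ext fun n => ?_
  simp only [coeff_mul, map_sum, LinearMap.sum_apply]
  rw [Finset.sum_sigma', Finset.sum_sigma']
  refine Finset.sum_nbij' (fun x => ⟨(x.2.1, x.2.2 + x.1.2), (x.2.2, x.1.2)⟩)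
    (fun x => ⟨(x.1.1 + x.2.1, x.2.2), (x.1.1, x.2.1)⟩) ?_ ?_ ?_ ?_ ?_
  · rintro ⟨⟨a, b⟩, ⟨c, d⟩⟩ hx
    simp only [Finset.mem_sigma, Finset.HasAntidiagonal.mem_antidiagonal] at hx ⊢
    obtain ⟨h1, h2⟩ := hx
    exact ⟨by omega, trivial⟩
  · rintro ⟨⟨a, b⟩, ⟨c, d⟩⟩ hx
    simp only [Finset.mem_sigma, Finset.HasAntidiagonal.mem_antidiagonal] at hx ⊢
    obtain ⟨h1, h2⟩ := hx
    exact ⟨by omega, trivial⟩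
  · rintro ⟨⟨a, b⟩, ⟨c, d⟩⟩ hx
    simp only [Finset.mem_sigma, Finset.HasAntidiagonal.mem_antidiagonal] at hx
    obtain ⟨h1, h2⟩ := hx
    subst h1 h2
    rfl
  · rintro ⟨⟨a, b⟩, ⟨c, d⟩⟩ hx
    simp only [Finset.mem_sigma, Finset.HasAntidiagonal.mem_antidiagonal] at hx
    obtain ⟨h1, h2⟩ := hx
    subst h1 h2
    rfl
  · rintro ⟨⟨a, b⟩, ⟨c, d⟩⟩ hx
    simp only [Finset.mem_sigma, Finset.HasAntidiagonal.mem_antidiagonal] at hx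
    obtain ⟨h1, h2⟩ := hx
    simp only
    rw [concatTo_of_eq h1, concatTo_of_eq h2, concatTo_of_eq rfl, concatTo_of_eq (by omega)]
    exact SymT.concat_assoc _ _ _ _ _ _ _

protected lemma mul_add (f g h : Series F V) : f * (g + h) = f * g + f * h := by
  refine ext fun n => ?_
  simp only [coeff_mul, map_add, Finset.sum_add_distrib]

noncomputable instance : CommRing (Series F V) where
  mul_assoc := Series.mul_assoc
  one_mul := Series.one_mul
  mul_one f := by rw [Series.mul_comm, Series.one_mul]
  mul_comm := Series.mul_comm
  left_distrib := Series.mul_add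
  right_distrib f g h := by
    rw [Series.mul_comm, Series.mul_add, Series.mul_comm h, Series.mul_comm h]
  zero_mul f := ext fun n => by simp [coeff_mul]
  mul_zero f := ext fun n => by simp [coeff_mul]
  zsmul := fun n f => n • f
  zsmul_zero' := SubNegMonoid.zsmul_zero'
  zsmul_succ' := SubNegMonoid.zsmul_succ'
  zsmul_neg' := SubNegMonoid.zsmul_neg'
  nsmul := fun n f => n • f
  nsmul_zero := AddMonoid.nsmul_zero
  nsmul_succ := AddMonoid.nsmul_succ
  neg_add_cancel := neg_add_cancel
  sub_eq_add_neg := sub_eq_add_neg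

noncomputable instance : Algebra F (Series F V) :=
  Algebra.ofModule
    (fun c f g => ext fun n => by simp [coeff_mul, Finset.smul_sum])
    (fun c f g => ext fun n => by simp [coeff_mul, Finset.smul_sum])

/-- If `f` vanishes below degree `a` and `g` below degree `b`, then `f * g` vanishes below degree
`a + b`. -/
lemma coeff_mul_eq_zero {f g : Series F V} {a b n : ℕ} (hf : ∀ i < a, coeff i f = 0)
    (hg : ∀ i < b, coeff i g = 0) (hn : n < a + b) : coeff n (f * g) = 0 := by
  rw [coeff_mul]
  refine Finset.sum_eq_zero fun p hp => ?_
  rw [Finset.HasAntidiagonal.mem_antidiagonal] at hp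
  by_cases h : p.1 < a
  · rw [hf _ h]; simp
  · rw [hg p.2 (by omega)]; simp

/-- The product of the `f i`, `i : Fin k`, vanishes below degree `k` if no `f i` has a constant
term. -/
lemma coeff_prod_eq_zero {k : ℕ} (f : Fin k → Series F V) (hf : ∀ i, coeff 0 (f i) = 0) {n : ℕ}
    (hn : n < k) : coeff n (∏ i, f i) = 0 := by
  induction k generalizing n with
  | zero => omega
  | succ k ih =>
    rw [Fin.prod_univ_succ]
    refine coeff_mul_eq_zero (a := 1) (b := k) (fun i hi => ?_) (fun i hi => ?_) (by omega)
    · obtain rfl : i = 0 := by omega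
      exact hf 0
    · exact ih _ (fun i => hf _) hi

end Series

namespace Pow

variable (F V) in
/-- A reduced power series, as a power series with zero constant term. -/
noncomputable def toSeries : Pow F V →ₗ[F] Series F V where
  toFun f := Series.mk fun
    | 0 => 0
    | k + 1 => f k.succPNat
  map_add' _ _ := Series.ext fun
    | 0 => (add_zero (0 : SymT F V 0)).symm
    | _ + 1 => rfl
  map_smul' c _ := Series.ext fun
    | 0 => (smul_zero (A := SymT F V 0) c).symm
    | _ + 1 => rfl

open Series (coeff)

@[simp] lemma coeff_zero_toSeries (f : Pow F V) : coeff 0 (toSeries F V f) = 0 := rfl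

@[simp] lemma coeff_toSeries (f : Pow F V) (n : ℕ+) : coeff n (toSeries F V f) = f n := by
  obtain ⟨k, rfl⟩ : ∃ k : ℕ, n = k.succPNat := ⟨_, n.succPNat_natPred.symm⟩
  rfl

lemma toSeries_ext {f : Pow F V} {g : Series F V} (h0 : coeff 0 g = 0)
    (h : ∀ n : ℕ+, f n = coeff n g) : toSeries F V f = g := by
  refine Series.ext fun n => ?_
  rcases Nat.eq_zero_or_pos n with rfl | hn
  · rw [h0]; rfl
  · exact (coeff_toSeries f ⟨n, hn⟩).trans (h ⟨n, hn⟩)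

lemma toSeries_injective : Function.Injective (toSeries F V) := fun f g h => by
  funext n
  rw [← coeff_toSeries f, h, coeff_toSeries]

/-- The multiplication of reduced power series: the degree `n` part of `f * g` is the sum over
`i + j = n` (with `i, j ≥ 1`) of the concatenations of `f i` with `g j`. -/
noncomputable def mul (f g : Pow F V) : Pow F V :=
  fun n => coeff n (toSeries F V f * toSeries F V g)

@[simp]
lemma toSeries_mul (f g : Pow F V) : toSeries F V (mul f g) = toSeries F V f * toSeries F V g :=
  toSeries_ext (Series.coeff_mul_eq_zero (a := 1) (b := 1) (by simp) (by simp) (by simp))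
    fun _ => rfl

/-- The functorial action of a linear map on reduced power series, in each degree
`v_1 ⋯ v_n ↦ f(v_1) ⋯ f(v_n)`. -/
noncomputable def map {W : Type w} [AddCommGroup W] [Module F W] (f : V →ₗ[F] W) :
    Pow F V →ₗ[F] Pow F W :=
  LinearMap.pi fun n : ℕ+ => SymT.map f n ∘ₗ LinearMap.proj n

variable (F V) in
/-- The inclusion `v ↦ (v, 0, 0, …)` of `V` in degree one. -/
noncomputable def unit : V →ₗ[F] Pow F V :=
  LinearMap.single F (fun n : ℕ+ => SymT F V n) 1 ∘ₗ
    (MultilinearMap.ofSubsingleton F V (SymT F V 1) (0 : Fin 1)).symm (SymT.mono 1)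

variable (F V) in
/-- The projection `t ↦ t(1)` onto degree one, where `V^{⊗1}` is identified with `V`. -/
noncomputable def proj : Pow F V →ₗ[F] V :=
  SymT.lift (MultilinearMap.ofSubsingleton F V V (0 : Fin 1) LinearMap.id)
    (fun σ v => by simp [Subsingleton.elim (σ 0) 0]) ∘ₗ
      LinearMap.proj (φ := fun n : ℕ+ => SymT F V n) 1

variable (F V) in
/-- The sum of the partial derivatives of a reduced power series, in each degree
`v_1 ⋯ v_n ↦ ∑ j, (∏ k ≠ j, (v_k, 0)) (0, v_j)`. -/
noncomputable def deriv : Pow F V →ₗ[F] Pow F (V × V) :=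
  LinearMap.pi fun n : ℕ+ => SymT.deriv n ∘ₗ LinearMap.proj n

variable (F V) in
/-- The multiplication `a_1 ⋯ a_k ↦ a_1 * ⋯ * a_k` of `k` reduced power series. The degree `n` part
of the right hand side is the sum over all `n_1 + ⋯ + n_k = n` with `n_j ≥ 1` of the
concatenations `a_1(n_1) * ⋯ * a_k(n_k)`. -/
noncomputable def multiply (k : ℕ) : SymT F (Pow F V) k →ₗ[F] Series F V :=
  SymT.lift ((MultilinearMap.mkPiAlgebra F (Fin k) (Series F V)).compLinearMap
    fun _ => toSeries F V) fun σ a => by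
      simpa using Equiv.prod_comp σ fun i => toSeries F V (a i)

variable (F V) in
/-- The composition of power series: the degree `n` part of `μ(s)` is
`∑_{k = 1}^n ∑_{n_1 + ⋯ + n_k = n} s(n_1, …, n_k)`, where for `s(k) = a_1 ⋯ a_k` with `a_j ∈ P(V)`
one puts `s(n_1, …, n_k) = a_1(n_1) * ⋯ * a_k(n_k)`, extended linearly in `s(k)`. -/
noncomputable def join : Pow F (Pow F V) →ₗ[F] Pow F V :=
  LinearMap.pi fun n : ℕ+ =>
    ∑ k ∈ Finset.Icc 1 n, coeff n ∘ₗ multiply F V k ∘ₗ LinearMap.proj k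

/-! ### The monad laws -/

lemma map_apply {W : Type w} [AddCommGroup W] [Module F W] (f : V →ₗ[F] W) (t : Pow F V)
    (n : ℕ+) : map f t n = SymT.map f n (t n) := rfl

lemma unit_one (v : V) : unit F V v 1 = SymT.mono 1 (fun _ => v) := by
  change (Pi.single (1 : ℕ+) _ : Pow F V) 1 = _
  rw [Pi.single_eq_same]; rfl

lemma unit_of_ne (v : V) {n : ℕ+} (h : n ≠ 1) : unit F V v n = 0 := by
  change (Pi.single (1 : ℕ+) _ : Pow F V) n = _
  rw [Pi.single_eq_of_ne h]

lemma multiply_mono (k : ℕ) (a : Fin k → Pow F V) :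
    multiply F V k (SymT.mono k a) = ∏ i, toSeries F V (a i) := by
  simp [multiply]

lemma coeff_multiply_eq_zero {k n : ℕ} (h : n < k) (x : SymT F (Pow F V) k) :
    coeff n (multiply F V k x) = 0 := by
  suffices H : coeff n ∘ₗ multiply F V k = 0 from congr($H x)
  refine SymT.hom_ext fun a => ?_
  simp only [LinearMap.comp_apply, multiply_mono, LinearMap.zero_apply]
  exact Series.coeff_prod_eq_zero _ (fun i => rfl) h

lemma multiply_concat {i j k : ℕ} (h : i + j = k) (x : SymT F (Pow F V) i)
    (y : SymT F (Pow F V) j) :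
    multiply F V k (SymT.concat h x y) = multiply F V i x * multiply F V j y := by
  suffices H : (multiply F V k) ∘ₗ (SymT.concat h).flip y =
      (LinearMap.mul F (Series F V)).flip (multiply F V j y) ∘ₗ multiply F V i from congr($H x)
  refine SymT.hom_ext fun v => ?_
  suffices H : (multiply F V k) ∘ₗ (SymT.concat h) (SymT.mono i v) =
      LinearMap.mul F (Series F V) (multiply F V i (SymT.mono i v)) ∘ₗ multiply F V j
    from congr($H y)
  refine SymT.hom_ext fun w => ?_
  subst h
  simp only [LinearMap.comp_apply, SymT.concat_mono, multiply_mono, Fin.prod_univ_add,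
    LinearMap.mul_apply']
  simp

lemma join_apply (s : Pow F (Pow F V)) (n : ℕ+) :
    join F V s n = ∑ k ∈ Finset.Icc 1 n, coeff n (multiply F V k (s k)) := by
  simp [join]

/-- The coefficients of `μ(s)`, where the sum may be taken over more terms than necessary. -/
lemma coeff_join (s : Pow F (Pow F V)) {n N : ℕ} (hN : n ≤ N) :
    coeff n (toSeries F V (join F V s)) = ∑ k ∈ Finset.range (N + 1),
      coeff n (multiply F V k (coeff k (toSeries F (Pow F V) s))) := by
  rcases Nat.eq_zero_or_pos n with rfl | hn
  · symm
    rw [coeff_zero_toSeries]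
    refine Finset.sum_eq_zero fun k _ => ?_
    rcases Nat.eq_zero_or_pos k with rfl | hk
    · simp
    · exact coeff_multiply_eq_zero hk _
  · lift n to ℕ+ using hn
    rw [coeff_toSeries, join_apply]
    have : ∀ k : ℕ+, coeff n (multiply F V k (s k)) =
      coeff n (multiply F V k (coeff k (toSeries F (Pow F V) s))) := fun k => by
        rw [coeff_toSeries]
    simp only [this]
    refine Finset.sum_bij_ne_zero (fun k _ _ => (k : ℕ)) ?_ ?_ ?_ ?_
    · intro k hk _
      have : (k : ℕ) ≤ n := (Finset.mem_Icc.1 hk).2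
      simp only [Finset.mem_range]
      omega
    · intro a _ _ b _ _ h
      exact PNat.coe_injective h
    · intro k hk hne
      have hk0 : 0 < k := by
        rcases Nat.eq_zero_or_pos k with rfl | hk0
        · simp at hne
        · exact hk0
      lift k to ℕ+ using hk0
      refine ⟨k, Finset.mem_Icc.2 ⟨one_le (a := k), ?_⟩, hne, rfl⟩
      by_contra hlt
      exact hne (coeff_multiply_eq_zero (by simpa using hlt) _)
    · intros; rfl

lemma join_mul (s t : Pow F (Pow F V)) : join F V (mul s t) = mul (join F V s) (join F V t) := by
  apply toSeries_injective
  refine Series.ext fun n => ?_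
  rw [coeff_join _ le_rfl]
  simp only [toSeries_mul, Series.coeff_mul, map_sum]
  have h1 : ∀ p ∈ Finset.HasAntidiagonal.antidiagonal n,
      concatTo p.1 p.2 n (coeff p.1 (toSeries F V (join F V s)))
        (coeff p.2 (toSeries F V (join F V t))) =
      ∑ i ∈ Finset.range (n + 1), ∑ j ∈ Finset.range (n + 1), concatTo p.1 p.2 n
        (coeff p.1 (multiply F V i (coeff i (toSeries F (Pow F V) s))))
        (coeff p.2 (multiply F V j (coeff j (toSeries F (Pow F V) t)))) := fun p hp => by
    rw [Finset.HasAntidiagonal.mem_antidiagonal] at hp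
    rw [coeff_join s (show p.1 ≤ n by omega), coeff_join t (show p.2 ≤ n by omega)]
    simp only [map_sum, LinearMap.sum_apply]
    rw [Finset.sum_comm]
  rw [Finset.sum_congr rfl h1, Finset.sum_comm]
  have h2 : ∀ i ∈ Finset.range (n + 1), (∑ p ∈ Finset.HasAntidiagonal.antidiagonal n,
      ∑ j ∈ Finset.range (n + 1), concatTo p.1 p.2 n
        (coeff p.1 (multiply F V i (coeff i (toSeries F (Pow F V) s))))
        (coeff p.2 (multiply F V j (coeff j (toSeries F (Pow F V) t))))) =
      ∑ j ∈ Finset.range (n + 1), coeff n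
        (multiply F V (i + j) (SymT.concat rfl (coeff i (toSeries F (Pow F V) s))
          (coeff j (toSeries F (Pow F V) t)))) := fun i _ => by
    rw [Finset.sum_comm]
    refine Finset.sum_congr rfl fun j _ => ?_
    rw [multiply_concat, Series.coeff_mul]
  rw [Finset.sum_congr rfl h2, Finset.sum_sigma', Finset.sum_sigma']
  refine Finset.sum_bij_ne_zero (fun x _ _ => ⟨x.2.1, x.2.2⟩) ?_ ?_ ?_ ?_
  · rintro ⟨k, i, j⟩ hx _
    simp only [Finset.mem_sigma, Finset.HasAntidiagonal.mem_antidiagonal, Finset.mem_range] at hx ⊢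
    omega
  · rintro ⟨k, i, j⟩ hx _ ⟨k', i', j'⟩ hx' _ h
    simp only [Finset.mem_sigma, Finset.HasAntidiagonal.mem_antidiagonal] at hx hx'
    obtain ⟨-, rfl⟩ := hx
    obtain ⟨-, rfl⟩ := hx'
    simp only [Sigma.mk.injEq, heq_eq_eq] at h
    obtain ⟨rfl, rfl⟩ := h
    rfl
  · rintro ⟨i, j⟩ hx hne
    have hij : i + j < n + 1 := by
      by_contra hlt
      exact hne (coeff_multiply_eq_zero (by dsimp only; omega) _)
    refine ⟨⟨i + j, (i, j)⟩, ?_, ?_, rfl⟩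
    · simpa using hij
    · simpa only [concatTo_of_eq rfl] using hne
  · rintro ⟨k, i, j⟩ hx _
    simp only [Finset.mem_sigma, Finset.HasAntidiagonal.mem_antidiagonal] at hx
    obtain ⟨-, rfl⟩ := hx
    simp only [concatTo_of_eq rfl]

lemma map_concat {W : Type w} [AddCommGroup W] [Module F W] (f : V →ₗ[F] W) {i j k : ℕ}
    (h : i + j = k) (x : SymT F V i) (y : SymT F V j) :
    SymT.map f k (SymT.concat h x y) = SymT.concat h (SymT.map f i x) (SymT.map f j y) := by
  suffices H : (SymT.map f k) ∘ₗ (SymT.concat h).flip y =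
      (SymT.concat h).flip (SymT.map f j y) ∘ₗ SymT.map f i from congr($H x)
  refine SymT.hom_ext fun v => ?_
  suffices H : (SymT.map f k) ∘ₗ (SymT.concat h) (SymT.mono i v) =
      (SymT.concat h) (SymT.map f i (SymT.mono i v)) ∘ₗ SymT.map f j from congr($H y)
  refine SymT.hom_ext fun w => ?_
  subst h
  simp only [LinearMap.comp_apply, SymT.concat_mono, SymT.map_mono]
  congr 1
  funext k
  refine Fin.addCases (fun a => ?_) (fun b => ?_) k <;> simp

lemma coeff_map {W : Type w} [AddCommGroup W] [Module F W] (f : V →ₗ[F] W) (t : Pow F V) (n : ℕ) :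
    coeff n (toSeries F W (map f t)) = SymT.map f n (coeff n (toSeries F V t)) := by
  rcases Nat.eq_zero_or_pos n with rfl | hn
  · simp
  · lift n to ℕ+ using hn
    simp [map_apply]

lemma map_mul {W : Type w} [AddCommGroup W] [Module F W] (f : V →ₗ[F] W) (s t : Pow F V) :
    map f (mul s t) = mul (map f s) (map f t) := by
  apply toSeries_injective
  refine Series.ext fun n => ?_
  rw [coeff_map]
  simp only [toSeries_mul, Series.coeff_mul, map_sum]
  refine Finset.sum_congr rfl fun p hp => ?_
  rw [Finset.HasAntidiagonal.mem_antidiagonal] at hp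
  rw [concatTo_of_eq hp, concatTo_of_eq hp, map_concat, coeff_map, coeff_map]

lemma map_unit {W : Type w} [AddCommGroup W] [Module F W] (f : V →ₗ[F] W) (v : V) :
    map f (unit F V v) = unit F W (f v) := by
  funext n
  rw [map_apply]
  by_cases h : n = 1
  · subst h
    rw [unit_one, unit_one]
    exact SymT.map_mono f 1 _
  · rw [unit_of_ne _ h, unit_of_ne _ h, LinearMap.map_zero]

lemma join_unit (t : Pow F V) : join F V (unit F (Pow F V) t) = t := by
  funext n
  rw [join_apply, Finset.sum_eq_single 1]
  · rw [unit_one]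
    refine (congr_arg (coeff n) (multiply_mono 1 _)).trans ?_
    simp
  · intro k _ hk
    simp [unit_of_ne _ hk]
  · intro h
    exact absurd (Finset.mem_Icc.2 ⟨le_rfl, one_le (a := n)⟩) h

/-- A linear map between modules of reduced power series which is multiplicative and whose value
in degree `n` only depends on the terms of degree at most `n`. -/
structure IsHom {W : Type w} [AddCommGroup W] [Module F W] (φ : Pow F V →ₗ[F] Pow F W) :
    Prop where
  mul (s t : Pow F V) : φ (mul s t) = Pow.mul (φ s) (φ t)
  trunc (s : Pow F V) (n : ℕ+) (h : ∀ k ≤ n, s k = 0) : ∀ k ≤ n, φ s k = 0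

lemma IsHom.comp {V₁ V₂ V₃ : Type*} [AddCommGroup V₁] [Module F V₁] [AddCommGroup V₂]
    [Module F V₂] [AddCommGroup V₃] [Module F V₃] {ψ : Pow F V₂ →ₗ[F] Pow F V₃}
    {φ : Pow F V₁ →ₗ[F] Pow F V₂} (hψ : IsHom ψ) (hφ : IsHom φ) : IsHom (ψ ∘ₗ φ) where
  mul s t := by simp only [LinearMap.comp_apply, hφ.mul, hψ.mul]
  trunc s n h := hψ.trunc _ n (hφ.trunc s n h)

lemma isHom_id : IsHom (LinearMap.id : Pow F V →ₗ[F] Pow F V) := ⟨fun _ _ => rfl, fun _ _ h => h⟩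

lemma isHom_map {W : Type w} [AddCommGroup W] [Module F W] (f : V →ₗ[F] W) : IsHom (map f) where
  mul := map_mul f
  trunc s n h k hk := by rw [map_apply, h k hk, LinearMap.map_zero]

lemma isHom_join : IsHom (join F V) where
  mul := join_mul
  trunc s n h k hk := by
    rw [join_apply]
    refine Finset.sum_eq_zero fun i hi => ?_
    rw [h i ((Finset.mem_Icc.1 hi).2.trans hk)]
    simp

/-- The power series concentrated in degree `n + 1` given by a product of `n + 1` vectors is the
product of the power series given by these vectors. -/
lemma single_mono_eq {n : ℕ} (v : Fin (n + 1 + 1) → V) :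
    (Pi.single (n + 1).succPNat (SymT.mono (n + 1 + 1) v) : Pow F V) =
      mul (unit F V (v 0)) (Pi.single n.succPNat
        (SymT.mono (n + 1) fun i => v i.succ)) := by
  apply toSeries_injective
  have key : ∀ (m : ℕ+) (x : SymT F V m) (k : ℕ), k ≠ m →
      coeff k (toSeries F V (Pi.single m x)) = 0 := by
    intro m x k hk
    rcases Nat.eq_zero_or_pos k with rfl | hk0
    · simp
    · lift k to ℕ+ using hk0
      rw [coeff_toSeries, Pi.single_eq_of_ne]
      rintro rfl
      exact hk rfl
  have key' : ∀ (m : ℕ+) (x : SymT F V m), coeff m (toSeries F V (Pi.single m x)) = x := by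
    intro m x
    rw [coeff_toSeries, Pi.single_eq_same]
  have hu : ∀ w : V, unit F V w = Pi.single (1 : ℕ+) (SymT.mono 1 fun _ => w) := fun w => rfl
  refine Series.ext fun m => ?_
  rw [toSeries_mul, Series.coeff_mul, hu]
  by_cases hm : m = n + 1 + 1
  · subst hm
    rw [Finset.sum_eq_single (1, n + 1)]
    · rw [concatTo_of_eq (add_comm _ _)]
      refine (key' (n + 1).succPNat _).trans ?_
      have e1 := key' 1 (SymT.mono (F := F) 1 fun _ => v 0)
      have e2 := key' n.succPNat (SymT.mono (F := F) (n + 1) fun i => v i.succ)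
      refine Eq.trans ?_ (congr_arg₂ (fun a b => SymT.concat (add_comm 1 (n + 1)) a b)
        e1.symm e2.symm)
      refine Eq.trans ?_ (SymT.concat_mono _ _ _).symm
      congr 1
      funext k
      refine Fin.cases ?_ (fun k => ?_) k
      · exact (Fin.append_left (fun _ => v 0) (fun i => v i.succ) (0 : Fin 1)).symm
      · have : Fin.cast (add_comm 1 (n + 1)).symm k.succ = Fin.natAdd 1 k := by
          ext; simp [add_comm]
        exact ((congr_arg _ this).trans
          (Fin.append_right (fun _ : Fin 1 => v 0) (fun i => v i.succ) k)).symm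
    · rintro ⟨i, j⟩ hij hne
      rw [Finset.HasAntidiagonal.mem_antidiagonal] at hij
      by_cases hi : i = 1
      · subst hi
        exact absurd (by simp at hij ⊢; omega) hne
      · dsimp only
        rw [key 1 (SymT.mono (F := F) 1 fun _ => v 0) i hi]
        simp
    · intro h
      exact absurd (by simp [add_comm]) h
  · refine (key (n + 1).succPNat (SymT.mono (n + 1 + 1) v) m hm).trans ?_
    symm
    refine Finset.sum_eq_zero ?_
    rintro ⟨i, j⟩ hij
    rw [Finset.HasAntidiagonal.mem_antidiagonal] at hij
    dsimp only at hij ⊢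
    by_cases hi : i = 1
    · rw [key n.succPNat (SymT.mono (F := F) (n + 1) fun i => v i.succ) j (by
        rw [Nat.succPNat_coe]; omega)]
      simp
    · rw [key 1 (SymT.mono (F := F) 1 fun _ => v 0) i hi]
      simp

/-- Such maps are determined by their values in degree one. -/
lemma IsHom.ext {W : Type w} [AddCommGroup W] [Module F W] {φ ψ : Pow F V →ₗ[F] Pow F W}
    (hφ : IsHom φ) (hψ : IsHom ψ) (h : ∀ v, φ (unit F V v) = ψ (unit F V v)) : φ = ψ := by
  have hmono : ∀ (n : ℕ) (v : Fin (n + 1) → V),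
      φ (Pi.single n.succPNat (SymT.mono (n + 1) v)) =
        ψ (Pi.single n.succPNat (SymT.mono (n + 1) v)) := by
    intro n
    induction n with
    | zero =>
      intro v
      have : v = fun _ => v 0 := by
        funext i
        exact congr_arg v (Subsingleton.elim (α := Fin 1) i 0)
      rw [this]
      exact h (v 0)
    | succ n ih =>
      intro v
      rw [single_mono_eq, hφ.mul, hψ.mul, h, ih]
  have hsingle : ∀ (k : ℕ+) (x : SymT F V k), φ (Pi.single k x) = ψ (Pi.single k x) := by
    intro k x
    obtain ⟨k, hk⟩ := k
    obtain ⟨n, rfl⟩ : ∃ n, k = n + 1 := ⟨k - 1, by omega⟩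
    have : φ ∘ₗ LinearMap.single F (fun n : ℕ+ => SymT F V n) n.succPNat =
        ψ ∘ₗ LinearMap.single F (fun n : ℕ+ => SymT F V n) n.succPNat :=
      SymT.hom_ext (hmono n)
    exact congr($this x)
  refine LinearMap.ext fun s => funext fun n => ?_
  have hs : ∀ k ≤ n, (s - ∑ i ∈ Finset.Icc 1 n, (Pi.single i (s i) : Pow F V)) k = 0 := by
    intro k hk
    rw [Pi.sub_apply, Finset.sum_apply, Finset.sum_eq_single k, Pi.single_eq_same, sub_self]
    · intro i _ hi
      exact Pi.single_eq_of_ne hi.symm _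
    · intro hk'
      exact absurd (Finset.mem_Icc.2 ⟨one_le (a := k), hk⟩) hk'
  have h1 := hφ.trunc _ n hs n le_rfl
  have h2 := hψ.trunc _ n hs n le_rfl
  rw [map_sub, map_sum, Pi.sub_apply, sub_eq_zero] at h1 h2
  rw [h1, h2]
  simp only [hsingle]

lemma join_comp_map_map {W : Type w} [AddCommGroup W] [Module F W] (f : V →ₗ[F] W) :
    join F W ∘ₗ map (map f) = map f ∘ₗ join F V :=
  (isHom_join.comp (isHom_map _)).ext ((isHom_map _).comp isHom_join) fun t => by
    simp only [LinearMap.comp_apply, map_unit, join_unit]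

lemma join_comp_map_join : join F V ∘ₗ map (join F V) = join F V ∘ₗ join F (Pow F V) :=
  (isHom_join.comp (isHom_map _)).ext (isHom_join.comp isHom_join) fun t => by
    simp only [LinearMap.comp_apply, map_unit, join_unit]

lemma join_comp_map_unit : join F V ∘ₗ map (unit F V) = LinearMap.id :=
  (isHom_join.comp (isHom_map _)).ext isHom_id fun v => by
    simp only [LinearMap.comp_apply, map_unit, join_unit, LinearMap.id_apply]

end Pow

end Series

/-- The endofunctor `P` of the category of `F`-modules. -/
noncomputable def powFunctor (F : Type u) [CommRing F] : ModuleCat.{u} F ⥤ ModuleCat.{u} F where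
  obj V := ModuleCat.of F (Pow F V)
  map f := ModuleCat.ofHom (Pow.map f.hom)
  map_id V := ModuleCat.hom_ext <| (Pow.isHom_map _).ext Pow.isHom_id fun v => Pow.map_unit _ v
  map_comp f g := ModuleCat.hom_ext <|
    (Pow.isHom_map _).ext ((Pow.isHom_map _).comp (Pow.isHom_map _)) fun v => by
      simp [Pow.map_unit]

/-- The free reduced power series algebra monad `(P, μ, η)`. -/
noncomputable def powMonad (F : Type u) [CommRing F] : Monad (ModuleCat.{u} F) where
  toFunctor := powFunctor F
  η := { app _ := ModuleCat.ofHom (Pow.unit F _)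
         naturality _ _ f := ModuleCat.hom_ext <| LinearMap.ext fun v =>
          (Pow.map_unit f.hom v).symm }
  μ := { app _ := ModuleCat.ofHom (Pow.join F _)
         naturality _ _ f := ModuleCat.hom_ext (Pow.join_comp_map_map f.hom) }
  assoc _ := ModuleCat.hom_ext Pow.join_comp_map_join
  left_unit _ := ModuleCat.hom_ext <| LinearMap.ext Pow.join_unit
  right_unit _ := ModuleCat.hom_ext Pow.join_comp_map_unit


/-- The comonad on `(ModuleCat F)ᵒᵖ` given by the free reduced power series algebra monad. -/
noncomputable def powComonad (F : Type u) [CommRing F] : Comonad (ModuleCat.{u} F)ᵒᵖ :=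
  CartDiff.opComonad (powMonad F)

end ReducedPowerSeries

/-!
Two independent arguments are combined.

*Formal part.* For a Cartesian differential comonad `(W, ∂)` on a category with finite biproducts,
`D[f] = f ∘ ∂` is a differential combinator on the coKleisli category
(`DifferentialCombinatorTransformation.combinator`). All structure maps (`ι₀`, `∇`, `ℓ`, `c` and the
projections) of the coKleisli category are images of those of the base category under the canonical
functor, and precomposition with the image of `g` is precomposition with `W.map g`
(`of_comp_of_toCok_eq`); so each axiom of a differential combinator becomes the corresponding axiom
of `∂`. A coKleisli map `f` is `D`-linear if and only if `f ∘ ∂ = f ∘ W(π₁)`. If there is a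
`D`-linear unit `η`, precomposing this equation with `W(ι₁)` gives `f ∘ η ∘ ε = f`
(`DLinearUnit.counit_comp_app_comp`). Hence `f ↦ f ∘ η` is inverse to the canonical functor onto the
`D`-linear maps.

*Power series.* In `(ModuleCat F)ᵒᵖ` the axioms become identities between linear maps out of
`P(V)`. All of them but the chain rule hold degreewise, and are checked on monomials `v_1 ⋯ v_n`,
where they say how the terms of the sum of partial derivatives behave when a factor vanishes or is a
sum. The chain rule `deriv_join` rests on the Leibniz rule `Series.deriv_mul` in the algebra of power
series, whose form for `k` factors (`Series.deriv_prod`) computes the derivative of the value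
`a_1 * ⋯ * a_k` of a monomial `a_1 ⋯ a_k` of the outer power series.
-/

namespace CartDiff

open CartesianLeftAdditive

/-! ### Pairings in a Cartesian left additive category -/

section Pairing

variable {X : Type u} [Category.{v} X] [CartesianLeftAdditive X]

lemma comp_pair {A B C E : X} (h : E ⟶ C) (f : C ⟶ A) (g : C ⟶ B) :
    h ≫ pair f g = pair (h ≫ f) (h ≫ g) :=
  pair_unique _ _ _ (by rw [Category.assoc, pair_fst]) (by rw [Category.assoc, pair_snd])

lemma pair_prodMap {A B C E Z : X} (h : Z ⟶ A) (k : Z ⟶ B) (f : A ⟶ C) (g : B ⟶ E) :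
    pair h k ≫ prodMap f g = pair (h ≫ f) (k ≫ g) := by
  rw [prodMap, comp_pair, ← Category.assoc, ← Category.assoc, pair_fst, pair_snd]

lemma inj₁_snd (A B : X) : inj₁ A B ≫ snd A B = 𝟙 B := pair_snd _ _

end Pairing

/-! ### The canonical functor to the coKleisli category -/

section Cokleisli

variable {X : Type u} [Category.{v} X] {W : Comonad X}

/-- The canonical functor from the base category to the coKleisli category, on maps. -/
abbrev toCok (W : Comonad X) {A B : X} (f : A ⟶ B) :
    Cokleisli.mk W A ⟶ Cokleisli.mk W B :=
  (Cokleisli.Adjunction.toCokleisli W).map f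

/-- Precomposition in the coKleisli category with a map of the base category. -/
lemma of_comp_of_toCok_eq {A B C : Cokleisli W} {f : A.of ⟶ B.of} {f' : A ⟶ B}
    (hf : toCok W f = f') (g : B ⟶ C) : (f' ≫ g).of = W.map f ≫ g.of := by
  subst hf
  change W.δ.app A.of ≫ W.map (W.ε.app A.of ≫ f) ≫ g.of = _
  rw [W.map_comp, Category.assoc, Comonad.right_counit_assoc]

lemma toCok_id (A : X) : toCok W (𝟙 A) = 𝟙 (Cokleisli.mk W A) :=
  (Cokleisli.Adjunction.toCokleisli W).map_id A

variable [CartesianLeftAdditive X]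

lemma toCok_fst (A B : X) : toCok W (fst A B) = fst (Cokleisli.mk W A) (Cokleisli.mk W B) := rfl

lemma toCok_snd (A B : X) : toCok W (snd A B) = snd (Cokleisli.mk W A) (Cokleisli.mk W B) := rfl

lemma toCok_pair {A B C : X} (f : C ⟶ A) (g : C ⟶ B) :
    toCok W (pair f g) = pair (toCok W f) (toCok W g) :=
  Cokleisli.hom_ext _ (comp_pair _ _ _)

lemma toCok_add {A B : X} (f g : A ⟶ B) : toCok W (f + g) = toCok W f + toCok W g :=
  Cokleisli.hom_ext _ (comp_add _ _ _)

lemma toCok_zero {A B : X} : toCok W (0 : A ⟶ B) = 0 :=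
  Cokleisli.hom_ext _ (comp_zero _)

lemma toCok_prodMap {A B C E : X} (f : A ⟶ C) (g : B ⟶ E) :
    toCok W (prodMap f g) = prodMap (toCok W f) (toCok W g) := by
  rw [prodMap, toCok_pair, toCok, toCok, Functor.map_comp, Functor.map_comp]
  rfl

lemma toCok_nabla (A : X) : toCok W (nabla A) = nabla (Cokleisli.mk W A) :=
  toCok_add _ _

lemma toCok_inj₀ (A B : X) : toCok W (inj₀ A B) = inj₀ (Cokleisli.mk W A) (Cokleisli.mk W B) := by
  rw [inj₀, toCok_pair, toCok_zero, toCok_id]; rfl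

lemma toCok_inj₁ (A B : X) : toCok W (inj₁ A B) = inj₁ (Cokleisli.mk W A) (Cokleisli.mk W B) := by
  rw [inj₁, toCok_pair, toCok_zero, toCok_id]; rfl

lemma toCok_lifting (A : X) : toCok W (lifting A) = lifting (Cokleisli.mk W A) := by
  rw [lifting, toCok_prodMap, toCok_inj₀, toCok_inj₁]; rfl

lemma toCok_interchange (A : X) : toCok W (interchange A) = interchange (Cokleisli.mk W A) := by
  rw [interchange, toCok_pair, toCok_prodMap, toCok_prodMap, toCok_fst, toCok_snd]; rfl

end Cokleisli

/-! ### The coKleisli category of a Cartesian differential comonad -/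

section Comonad

variable {X : Type u} [Category.{v} X] [FiniteBiproducts X] {W : Comonad X}

namespace DifferentialCombinatorTransformation

variable (d : DifferentialCombinatorTransformation W)

/-- The differential combinator `D[f] = f ∘ ∂` on the coKleisli category of a Cartesian
differential comonad. -/
def combinator : DifferentialCombinator (Cokleisli W) where
  deriv {A B} f := ⟨d.app A.of ≫ f.of⟩
  deriv_add f g := Cokleisli.hom_ext _ (comp_add _ _ _)
  deriv_zero := Cokleisli.hom_ext _ (comp_zero _)
  nabla_deriv {A B} f := Cokleisli.hom_ext _ <| by
    have h (g : prodObj A.of A.of ⟶ A.of) (g' : prodObj A A ⟶ A) (hg : toCok W g = g') :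
        toCok W (prodMap (𝟙 A.of) g) = prodMap (𝟙 A) g' := by
      rw [toCok_prodMap, toCok_id, hg]
    refine (of_comp_of_toCok_eq (h _ _ (toCok_nabla A.of)) _).trans ?_
    refine Eq.trans ?_ (congr_arg₂ (· + ·) (of_comp_of_toCok_eq (h _ _ rfl) _)
      (of_comp_of_toCok_eq (h _ _ rfl) _)).symm
    simp only [← Category.assoc]
    rw [d.additive_rule, (FiniteBiproducts.isAdditive (d.app A.of)).1,
      (FiniteBiproducts.isAdditive f.of).1]
  inj₀_deriv {A B} f := Cokleisli.hom_ext _ <| by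
    refine (of_comp_of_toCok_eq (toCok_inj₀ A.of A.of) _).trans ?_
    rw [← Category.assoc, d.zero_rule, (FiniteBiproducts.isAdditive f.of).2]
    rfl
  deriv_id A := Cokleisli.hom_ext _ (d.linear_rule A.of)
  deriv_fst A B := Cokleisli.hom_ext _ <| by
    refine Eq.trans ?_ (of_comp_of_toCok_eq rfl (fst A B)).symm
    change d.app _ ≫ W.ε.app _ ≫ fst _ _ = W.map (snd _ _) ≫ W.ε.app _ ≫ fst _ _
    rw [← Category.assoc, d.linear_rule, Comonad.counit_naturality_assoc, Category.assoc]
  deriv_snd A B := Cokleisli.hom_ext _ <| by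
    refine Eq.trans ?_ (of_comp_of_toCok_eq rfl (snd A B)).symm
    change d.app _ ≫ W.ε.app _ ≫ snd _ _ = W.map (snd _ _) ≫ W.ε.app _ ≫ snd _ _
    rw [← Category.assoc, d.linear_rule, Comonad.counit_naturality_assoc, Category.assoc]
  deriv_pair f g := Cokleisli.hom_ext _ (comp_pair _ _ _)
  deriv_comp {A B C} f g := Cokleisli.hom_ext _ <| by
    have h : (fst A A ≫ f).of = W.map (fst A.of A.of) ≫ f.of := of_comp_of_toCok_eq rfl _
    change d.app A.of ≫ W.δ.app A.of ≫ W.map f.of ≫ g.of = W.δ.app (prodObj A.of A.of) ≫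
      W.map (pair (fst A A ≫ f).of (d.app A.of ≫ f.of)) ≫ d.app B.of ≫ g.of
    rw [h]
    rw [← Category.assoc, d.chain_rule, ← pair_prodMap, W.map_comp]
    simp only [Category.assoc]
    rw [← Category.assoc (d.app _) (W.map f.of), ← d.naturality]
    simp only [Category.assoc]
  lifting_deriv {A B} f := Cokleisli.hom_ext _ <| by
    refine (of_comp_of_toCok_eq (toCok_lifting A.of) _).trans ?_
    have h := congr_arg (· ≫ f.of) (d.lift_rule A.of)
    simp only [Category.assoc] at h
    exact h
  interchange_deriv {A B} f := Cokleisli.hom_ext _ <| by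
    refine (of_comp_of_toCok_eq (toCok_interchange A.of) _).trans ?_
    have h := congr_arg (· ≫ f.of) (d.symmetry_rule A.of)
    simp only [Category.assoc] at h
    exact h

lemma isLinear_iff {A B : Cokleisli W} (f : A ⟶ B) :
    d.combinator.IsLinear f ↔ d.app A.of ≫ f.of = W.map (snd A.of A.of) ≫ f.of := by
  have h : (snd A A ≫ f).of = W.map (snd A.of A.of) ≫ f.of := of_comp_of_toCok_eq rfl _
  rw [← h]
  exact ⟨congr_arg Cokleisli.Hom.of, Cokleisli.hom_ext _⟩

lemma isLinear_toCok {A B : X} (f : A ⟶ B) : d.combinator.IsLinear (toCok W f) := by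
  rw [isLinear_iff]
  change d.app A ≫ W.ε.app A ≫ f = W.map _ ≫ W.ε.app A ≫ f
  rw [← Category.assoc, d.linear_rule, Comonad.counit_naturality_assoc, Category.assoc]

/-- The canonical functor to the coKleisli category, with values in the subcategory of `D`-linear
maps. -/
def toLin : X ⥤ d.combinator.Lin where
  obj A := ⟨Cokleisli.mk W A⟩
  map f := ⟨toCok W f, d.isLinear_toCok f⟩
  map_id A := WideSubcategory.hom_ext _ (toCok_id A)
  map_comp f g := WideSubcategory.hom_ext _ ((Cokleisli.Adjunction.toCokleisli W).map_comp f g)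

end DifferentialCombinatorTransformation

/-! ### `D`-linear maps and the `D`-linear unit -/

namespace DLinearUnit

variable {d : DifferentialCombinatorTransformation W} (u : DLinearUnit d)

/-- A `D`-linear map `f` is recovered from the map `η ≫ f` of the base category, because
`ε ≫ η ≫ f = !(ι₁) ≫ ∂ ≫ f = !(ι₁) ≫ !(π₁) ≫ f = f`. -/
lemma counit_comp_app_comp {A B : Cokleisli W} {f : A ⟶ B} (hf : d.combinator.IsLinear f) :
    W.ε.app A.of ≫ u.app A.of ≫ f.of = f.of := by
  rw [d.isLinear_iff] at hf
  rw [← Category.assoc, u.linearization, Category.assoc, hf, ← Category.assoc, ← W.map_comp,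
    inj₁_snd, W.map_id, Category.id_comp]

/-- The functor sending a `D`-linear map `f` of the coKleisli category to `η ≫ f`. -/
def ofLin : d.combinator.Lin ⥤ X where
  obj A := A.obj.of
  map {A B} f := u.app A.obj.of ≫ f.hom.of
  map_id A := u.linear A.obj.of
  map_comp {A B C} f g := by
    change u.app _ ≫ W.δ.app _ ≫ W.map f.hom.of ≫ g.hom.of =
      (u.app _ ≫ f.hom.of) ≫ u.app _ ≫ g.hom.of
    -- Write `f` as `ε ≫ η ≫ f`; then `δ ≫ !ε = 1` and the naturality of `η` give the claim.
    rw [← u.counit_comp_app_comp f.property, W.map_comp, Category.assoc,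
      Comonad.right_counit_assoc, ← Category.assoc (u.app _) (W.ε.app _), u.linear,
      Category.id_comp, Category.assoc, ← Category.assoc (u.app _) (W.map _), ← u.naturality,
      Category.assoc, Category.assoc]

lemma toLin_comp_ofLin : d.toLin ⋙ u.ofLin = 𝟭 X :=
  CategoryTheory.Functor.hext (fun _ => rfl) fun A _ f => heq_of_eq <| by
    change u.app A ≫ W.ε.app A ≫ f = f
    rw [← Category.assoc, u.linear, Category.id_comp]

lemma ofLin_comp_toLin : u.ofLin ⋙ d.toLin = 𝟭 d.combinator.Lin :=
  CategoryTheory.Functor.hext (fun _ => rfl) fun _ _ f => heq_of_eq <|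
    WideSubcategory.hom_ext _ (Cokleisli.hom_ext _ (u.counit_comp_app_comp f.property))

end DLinearUnit

end Comonad

end CartDiff

namespace ReducedPowerSeries

section Derivative

variable {F : Type u} [CommRing F] {V : Type v} [AddCommGroup V] [Module F V]

/-! ### The derivative of symmetrized tensors -/

namespace SymT

lemma deriv_mono_update (n : ℕ) (v : Fin n → V) :
    deriv (F := F) n (mono n v) =
      ∑ j, mono n (Function.update (fun k => (v k, (0 : V))) j ((0 : V), v j)) := by
  rw [deriv_mono]
  refine Finset.sum_congr rfl fun j _ => congr_arg _ (funext fun k => ?_)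
  rw [Function.update_apply]
  split_ifs with h
  · rw [h]
  · rfl

lemma map_deriv_mono {W : Type w} [AddCommGroup W] [Module F W] (g : V × V →ₗ[F] W) (n : ℕ)
    (v : Fin n → V) :
    map g n (deriv n (mono n v)) =
      ∑ j, mono n (Function.update (fun k => g (v k, 0)) j (g (0, v j))) := by
  rw [deriv_mono_update, map_sum]
  refine Finset.sum_congr rfl fun j _ => ?_
  rw [map_mono]
  exact congr_arg _ (Function.comp_update g _ j _)

lemma map_prodMap_deriv {W : Type w} [AddCommGroup W] [Module F W] (f : V →ₗ[F] W) (n : ℕ)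
    (x : SymT F V n) : map (f.prodMap f) n (deriv n x) = deriv n (map f n x) := by
  suffices H : map (f.prodMap f) n ∘ₗ deriv n = deriv n ∘ₗ map f n from congr($H x)
  refine hom_ext fun v => ?_
  rw [LinearMap.comp_apply, LinearMap.comp_apply, map_deriv_mono, map_mono, deriv_mono_update]
  simp

lemma map_fst_deriv (n : ℕ) (x : SymT F V n) : map (LinearMap.fst F V V) n (deriv n x) = 0 := by
  suffices H : map (LinearMap.fst F V V) n ∘ₗ deriv n = 0 from congr($H x)
  refine hom_ext fun v => ?_
  rw [LinearMap.comp_apply, map_deriv_mono]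
  exact Finset.sum_eq_zero fun j _ => MultilinearMap.map_update_zero _ _ _

/-- The derivative is additive in the direction: if `g`, `g₁`, `g₂` agree on base points `(v, 0)` and
`g = g₁ + g₂` on directions `(0, v)`, then `g ∘ ∂ = g₁ ∘ ∂ + g₂ ∘ ∂`. -/
lemma map_deriv_add {W : Type w} [AddCommGroup W] [Module F W] {g g₁ g₂ : V × V →ₗ[F] W}
    (h₁ : ∀ v, g (v, 0) = g₁ (v, 0)) (h₂ : ∀ v, g (v, 0) = g₂ (v, 0))
    (h : ∀ v, g (0, v) = g₁ (0, v) + g₂ (0, v)) (n : ℕ) (x : SymT F V n) :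
    map g n (deriv n x) = map g₁ n (deriv n x) + map g₂ n (deriv n x) := by
  suffices H : map g n ∘ₗ deriv n = map g₁ n ∘ₗ deriv n + map g₂ n ∘ₗ deriv n from congr($H x)
  refine hom_ext fun v => ?_
  simp only [LinearMap.comp_apply, LinearMap.add_apply, map_deriv_mono, ← h₁, ← h₂, h,
    MultilinearMap.map_update_add, Finset.sum_add_distrib]

/-- Of the terms of `∂∂(v_1 ⋯ v_n)`, the map `((a, b), (c, e)) ↦ (a, e)` keeps those in which both
derivatives hit the same factor. -/
lemma map_lift_deriv_deriv (n : ℕ) (x : SymT F V n) :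
    map ((LinearMap.fst F V V).prodMap (LinearMap.snd F V V)) n (deriv n (deriv n x)) =
      deriv n x := by
  suffices H : map ((LinearMap.fst F V V).prodMap (LinearMap.snd F V V)) n ∘ₗ deriv n ∘ₗ
    deriv n = deriv n from congr($H x)
  refine hom_ext fun v => ?_
  simp only [LinearMap.comp_apply, deriv_mono_update n v, map_sum, map_deriv_mono]
  refine Finset.sum_congr rfl fun j _ => ?_
  rw [Finset.sum_eq_single j]
  · refine congr_arg _ (funext fun k => ?_)
    by_cases h : k = j
    · subst h; simp
    · simp [h]
  · intro i _ hi
    -- The `j`-th factor is `((0, v j), (0, 0))`, which `fst × snd` sends to zero.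
    refine MultilinearMap.map_coord_zero _ j ?_
    rw [Function.update_of_ne hi.symm]
    simp
  · simp

/-- The interchange map swaps the factors hit by the first and by the second derivative. -/
lemma map_interchange_deriv_deriv {g : (V × V) × (V × V) →ₗ[F] (V × V) × (V × V)}
    (hg : ∀ a b c e, g ((a, b), (c, e)) = ((a, c), (b, e))) (n : ℕ) (x : SymT F V n) :
    map g n (deriv n (deriv n x)) = deriv n (deriv n x) := by
  suffices H : map g n ∘ₗ deriv n ∘ₗ deriv n = deriv n ∘ₗ deriv n from congr($H x)
  refine hom_ext fun v => ?_
  simp only [LinearMap.comp_apply, deriv_mono, map_sum, map_mono]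
  rw [Finset.sum_comm]
  refine Finset.sum_congr rfl fun i _ => Finset.sum_congr rfl fun j _ =>
    congr_arg _ (funext fun k => ?_)
  split_ifs <;> exact hg _ _ _ _

lemma map_snd_deriv_of_one_lt {n : ℕ} (hn : 1 < n) (x : SymT F V n) :
    map (LinearMap.snd F V V) n (deriv n x) = 0 := by
  suffices H : map (LinearMap.snd F V V) n ∘ₗ deriv n = 0 from congr($H x)
  refine hom_ext fun v => ?_
  rw [LinearMap.comp_apply, map_deriv_mono]
  refine Finset.sum_eq_zero fun j _ => ?_
  have : Nontrivial (Fin n) := Fin.nontrivial_iff_two_le.2 hn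
  obtain ⟨k, hk⟩ := exists_ne j
  -- Any factor other than the `j`-th is `(v k, 0)`.
  refine MultilinearMap.map_coord_zero _ k ?_
  rw [Function.update_of_ne hk]
  rfl

/-- The identification of `(V^{⊗1})_{S(1)}` with `V`. -/
noncomputable def ofOne : SymT F V 1 →ₗ[F] V :=
  lift (MultilinearMap.ofSubsingleton F V V (0 : Fin 1) LinearMap.id)
    (fun σ v => by simp [Subsingleton.elim (σ 0) 0])

lemma ofOne_mono (v : V) : ofOne (mono (F := F) 1 fun _ => v) = v := lift_mono _ _ _

lemma mono_ofOne (x : SymT F V 1) : (mono 1 fun _ => ofOne x) = x := by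
  suffices H : (MultilinearMap.ofSubsingleton F V (SymT F V 1) (0 : Fin 1)).symm (mono 1) ∘ₗ
      ofOne = LinearMap.id from congr($H x)
  refine hom_ext fun v => ?_
  rw [LinearMap.comp_apply, ofOne, lift_mono]
  exact congr_arg (mono 1) (funext fun k => congr_arg v (Subsingleton.elim _ _))

lemma ofOne_map {W : Type w} [AddCommGroup W] [Module F W] (f : V →ₗ[F] W) (x : SymT F V 1) :
    ofOne (map f 1 x) = f (ofOne x) := by
  rw [← mono_ofOne x, map_mono, ofOne_mono, ofOne_mono]

/-- The Leibniz rule for the concatenation product. -/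
lemma deriv_concat {i j n : ℕ} (h : i + j = n) (x : SymT F V i) (y : SymT F V j) :
    deriv n (concat h x y) = concat h (deriv i x) (map (LinearMap.inl F V V) j y) +
      concat h (map (LinearMap.inl F V V) i x) (deriv j y) := by
  suffices H : deriv n ∘ₗ (concat h).flip y =
      (concat h).flip (map (LinearMap.inl F V V) j y) ∘ₗ deriv i +
        (concat h).flip (deriv j y) ∘ₗ map (LinearMap.inl F V V) i from congr($H x)
  refine hom_ext fun v => ?_
  suffices H : deriv n ∘ₗ concat h (mono i v) =
      concat h (deriv i (mono i v)) ∘ₗ map (LinearMap.inl F V V) j +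
        concat h (map (LinearMap.inl F V V) i (mono i v)) ∘ₗ deriv j from congr($H y)
  refine hom_ext fun u => ?_
  subst h
  simp only [LinearMap.comp_apply, LinearMap.add_apply, concat_mono, deriv_mono, map_mono,
    map_sum, LinearMap.sum_apply, Fin.sum_univ_add]
  refine congr_arg₂ (· + ·) (Finset.sum_congr rfl fun a _ => congr_arg _ (funext fun k => ?_))
    (Finset.sum_congr rfl fun a _ => congr_arg _ (funext fun k => ?_)) <;>
  refine Fin.addCases (fun b => ?_) (fun b => ?_) k <;>
  simp [Fin.ext_iff] <;> try (intros; omega)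

end SymT

/-! ### The Leibniz rule for power series -/

namespace Series

/-- The algebra homomorphism `v_1 ⋯ v_n ↦ (v_1, 0) ⋯ (v_n, 0)` between power series. -/
noncomputable def mapInl : Series F V →ₐ[F] Series F (V × V) :=
  AlgHom.ofLinearMap
    (LinearMap.pi fun n => SymT.map (LinearMap.inl F V V) n ∘ₗ coeff n :
      Series F V →ₗ[F] ∀ n, SymT F (V × V) n)
    (Series.ext fun n => by
      change SymT.map _ n (coeff n 1) = coeff n 1
      rcases eq_or_ne n 0 with rfl | hn
      · rw [coeff_zero_one, coeff_zero_one, SymT.map_mono]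
        exact congr_arg _ (Subsingleton.elim _ _)
      · rw [coeff_one_of_ne hn, coeff_one_of_ne hn, map_zero])
    fun f g => Series.ext fun n => by
      change SymT.map _ n (coeff n (f * g)) = ∑ p ∈ Finset.HasAntidiagonal.antidiagonal n,
        concatTo p.1 p.2 n (SymT.map _ p.1 (coeff p.1 f)) (SymT.map _ p.2 (coeff p.2 g))
      rw [coeff_mul, map_sum]
      refine Finset.sum_congr rfl fun p hp => ?_
      rw [Finset.HasAntidiagonal.mem_antidiagonal] at hp
      rw [concatTo_of_eq hp, concatTo_of_eq hp, Pow.map_concat]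

lemma coeff_mapInl (f : Series F V) (n : ℕ) :
    coeff n (mapInl f) = SymT.map (LinearMap.inl F V V) n (coeff n f) := rfl

/-- The sum of the partial derivatives of a power series. -/
noncomputable def deriv : Series F V →ₗ[F] Series F (V × V) :=
  (LinearMap.pi fun n => SymT.deriv n ∘ₗ coeff n :
    Series F V →ₗ[F] ∀ n, SymT F (V × V) n)

lemma coeff_deriv (f : Series F V) (n : ℕ) : coeff n (deriv f) = SymT.deriv n (coeff n f) := rfl

lemma deriv_one : deriv (1 : Series F V) = 0 := by
  refine Series.ext fun n => ?_
  rw [coeff_deriv, map_zero]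
  rcases eq_or_ne n 0 with rfl | hn
  · rw [coeff_zero_one, SymT.deriv_mono]
    rfl
  · rw [coeff_one_of_ne hn, map_zero]

lemma deriv_mul (f g : Series F V) :
    deriv (f * g) = deriv f * mapInl g + mapInl f * deriv g := by
  refine Series.ext fun n => ?_
  simp only [coeff_deriv, coeff_mul, map_add, map_sum, coeff_mapInl, ← Finset.sum_add_distrib]
  refine Finset.sum_congr rfl fun p hp => ?_
  rw [Finset.HasAntidiagonal.mem_antidiagonal] at hp
  rw [concatTo_of_eq hp, concatTo_of_eq hp, SymT.deriv_concat]

lemma deriv_prod {k : ℕ} (f : Fin k → Series F V) :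
    deriv (∏ i, f i) = ∑ j, ∏ i, if i = j then deriv (f i) else mapInl (f i) := by
  induction k with
  | zero => simp [deriv_one]
  | succ k ih =>
    simp only [Fin.prod_univ_succ, deriv_mul, ih, Fin.sum_univ_succ, map_prod, Finset.mul_sum]
    simp [Fin.succ_ne_zero, (Fin.succ_ne_zero _).symm]

end Series

/-! ### The chain rule, and the part of degree one -/

namespace Pow

open Series (coeff)

lemma deriv_apply (t : Pow F V) (n : ℕ+) : deriv F V t n = SymT.deriv n (t n) := rfl

lemma toSeries_deriv (t : Pow F V) :
    toSeries F (V × V) (deriv F V t) = Series.deriv (toSeries F V t) :=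
  toSeries_ext (by rw [Series.coeff_deriv, coeff_zero_toSeries, map_zero]) fun n => by
    rw [Series.coeff_deriv, coeff_toSeries, deriv_apply]

lemma toSeries_map_inl (t : Pow F V) :
    toSeries F (V × V) (map (LinearMap.inl F V V) t) = Series.mapInl (toSeries F V t) :=
  toSeries_ext (by rw [Series.coeff_mapInl, coeff_zero_toSeries, map_zero]) fun n => by
    rw [Series.coeff_mapInl, coeff_toSeries, map_apply]

/-- The Leibniz rule for a product `a_1 * ⋯ * a_k` of power series: on the right hand side one
factor `a_j` of the monomial `a_1 ⋯ a_k` is replaced by its derivative, and the others by their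
images under `v ↦ (v, 0)`. -/
lemma deriv_multiply (k : ℕ) (x : SymT F (Pow F V) k) :
    Series.deriv (multiply F V k x) = multiply F (V × V) k
      (SymT.map ((map (LinearMap.inl F V V)).coprod (deriv F V)) k (SymT.deriv k x)) := by
  suffices H : Series.deriv ∘ₗ multiply F V k = multiply F (V × V) k ∘ₗ
      SymT.map ((map (LinearMap.inl F V V)).coprod (deriv F V)) k ∘ₗ SymT.deriv k
    from congr($H x)
  refine SymT.hom_ext fun a => ?_
  simp only [LinearMap.comp_apply, multiply_mono, SymT.deriv_mono, SymT.map_mono, map_sum,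
    Series.deriv_prod]
  refine Finset.sum_congr rfl fun j _ => Finset.prod_congr rfl fun i _ => ?_
  split_ifs
  · simp [toSeries_deriv]
  · simp [toSeries_map_inl]

/-- The chain rule: the derivative of a composition of power series. -/
lemma deriv_join (s : Pow F (Pow F V)) :
    deriv F V (join F V s) = join F (V × V)
      (map ((map (LinearMap.inl F V V)).coprod (deriv F V)) (deriv F (Pow F V) s)) := by
  funext n
  simp only [deriv_apply, join_apply, map_sum, map_apply]
  refine Finset.sum_congr rfl fun k _ => ?_
  rw [← Series.coeff_deriv, deriv_multiply]

lemma deriv_unit (v : V) : deriv F V (unit F V v) = unit F (V × V) (0, v) := by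
  funext n
  rw [deriv_apply]
  by_cases h : n = 1
  · subst h
    rw [unit_one, unit_one]
    refine (SymT.deriv_mono 1 _).trans ?_
    simp only [Finset.univ_unique, Finset.sum_singleton]
    refine congr_arg _ (funext fun k => if_pos (Subsingleton.elim (α := Fin 1) _ _))
  · rw [unit_of_ne _ h, unit_of_ne _ h, map_zero]

lemma proj_apply (t : Pow F V) : proj F V t = SymT.ofOne (t 1) := rfl

lemma proj_unit (v : V) : proj F V (unit F V v) = v := by
  rw [proj_apply, unit_one]
  exact SymT.ofOne_mono v

lemma proj_map {W : Type w} [AddCommGroup W] [Module F W] (f : V →ₗ[F] W) (t : Pow F V) :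
    proj F W (map f t) = f (proj F V t) :=
  SymT.ofOne_map f (t 1)

/-- Differentiation at the base point zero leaves only the linear part of a power series. -/
lemma map_snd_deriv (t : Pow F V) :
    map (LinearMap.snd F V V) (deriv F V t) = unit F V (proj F V t) := by
  funext n
  rw [map_apply, deriv_apply]
  by_cases h : n = 1
  · subst h
    rw [proj_apply, unit_one]
    refine (congr_arg (fun x => SymT.map _ 1 (SymT.deriv 1 x))
      (SymT.mono_ofOne (t 1)).symm).trans ?_
    refine (SymT.map_deriv_mono _ 1 _).trans ?_
    rw [Fin.sum_univ_one]
    exact congr_arg _ (funext fun k => by rw [Subsingleton.elim k 0, Function.update_self]; rfl)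
  · rw [unit_of_ne _ h, SymT.map_snd_deriv_of_one_lt]
    exact lt_of_le_of_ne n.pos fun h' => h (PNat.eq h'.symm)

end Pow

end Derivative

end ReducedPowerSeries

namespace ReducedPowerSeries

/-! ### Structure maps of `(ModuleCat F)ᵒᵖ` as linear maps -/

section Opposite

open CartDiff CartesianLeftAdditive

variable {F : Type u} [Ring F] {A B C E : (ModuleCat.{v} F)ᵒᵖ}

lemma unop_prodMap (f : A ⟶ C) (g : B ⟶ E) :
    (prodMap f g).unop.hom = f.unop.hom.prodMap g.unop.hom :=
  LinearMap.ext fun _ => Prod.ext (add_zero _) (zero_add _)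

lemma unop_nabla (A : (ModuleCat.{v} F)ᵒᵖ) :
    (nabla A).unop.hom = LinearMap.inl F A.unop A.unop + LinearMap.inr F A.unop A.unop := rfl

lemma unop_inj₀ (A B : (ModuleCat.{v} F)ᵒᵖ) :
    (inj₀ A B).unop.hom = LinearMap.fst F A.unop B.unop :=
  LinearMap.ext fun x => add_zero x.1

lemma unop_inj₁ (A B : (ModuleCat.{v} F)ᵒᵖ) :
    (inj₁ A B).unop.hom = LinearMap.snd F A.unop B.unop :=
  LinearMap.ext fun x => zero_add x.2

lemma unop_lifting (A : (ModuleCat.{v} F)ᵒᵖ) : (lifting A).unop.hom =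
    (LinearMap.fst F A.unop A.unop).prodMap (LinearMap.snd F A.unop A.unop) := by
  rw [lifting, unop_prodMap, unop_inj₀, unop_inj₁]

lemma unop_interchange_apply (A : (ModuleCat.{v} F)ᵒᵖ) (a b c e : A.unop) :
    (interchange A).unop.hom ((a, b), (c, e)) = ((a, c), (b, e)) := by
  change (prodMap (fst A A) (fst A A)).unop.hom (a, b) +
    (prodMap (snd A A) (snd A A)).unop.hom (c, e) = _
  rw [unop_prodMap, unop_prodMap]
  exact Prod.ext (Prod.ext (add_zero _) (zero_add _)) (Prod.ext (add_zero _) (zero_add _))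

end Opposite

/-! ### Power series as a Cartesian differential comonad -/

open CartDiff CartesianLeftAdditive

variable (F : Type u) [CommRing F]

/-- The sum of partial derivatives, as a differential combinator transformation: it makes the free
reduced power series algebra monad a Cartesian differential comonad on `(ModuleCat F)ᵒᵖ`. -/
noncomputable def powDeriv : DifferentialCombinatorTransformation (powComonad F) where
  app V := (ModuleCat.ofHom (Pow.deriv F V.unop)).op
  naturality {V W} f := Quiver.Hom.unop_inj <| ModuleCat.hom_ext <| LinearMap.ext fun t =>
    funext fun n => by
      change SymT.map (prodMap f f).unop.hom n (SymT.deriv n (t n)) =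
        SymT.deriv n (SymT.map f.unop.hom n (t n))
      rw [unop_prodMap, SymT.map_prodMap_deriv]
  zero_rule V := Quiver.Hom.unop_inj <| ModuleCat.hom_ext <| LinearMap.ext fun t =>
    funext fun n => by
      change SymT.map (inj₀ V V).unop.hom n (SymT.deriv n (t n)) = 0
      rw [unop_inj₀, SymT.map_fst_deriv]
  additive_rule V := Quiver.Hom.unop_inj <| ModuleCat.hom_ext <| LinearMap.ext fun t =>
    funext fun n => by
      change SymT.map (prodMap (𝟙 V) (nabla V)).unop.hom n (SymT.deriv n (t n)) =
        SymT.map (prodMap (𝟙 V) (fst V V)).unop.hom n (SymT.deriv n (t n)) +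
          SymT.map (prodMap (𝟙 V) (snd V V)).unop.hom n (SymT.deriv n (t n))
      rw [unop_prodMap, unop_prodMap, unop_prodMap, unop_nabla]
      refine SymT.map_deriv_add (fun v => ?_) (fun v => ?_) (fun v => ?_) n (t n)
      · exact Prod.ext rfl ((map_zero (LinearMap.inl F V.unop V.unop +
          LinearMap.inr F V.unop V.unop)).trans (map_zero (fst V V).unop.hom).symm)
      · exact Prod.ext rfl ((map_zero (LinearMap.inl F V.unop V.unop +
          LinearMap.inr F V.unop V.unop)).trans (map_zero (snd V V).unop.hom).symm)
      · exact Prod.ext (add_zero _).symm rfl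
  linear_rule V := Quiver.Hom.unop_inj <| ModuleCat.hom_ext <| LinearMap.ext fun v =>
    Pow.deriv_unit (F := F) (V := V.unop) v
  chain_rule V := Quiver.Hom.unop_inj <| ModuleCat.hom_ext <| LinearMap.ext fun s =>
    Pow.deriv_join (F := F) (V := V.unop) s
  lift_rule V := Quiver.Hom.unop_inj <| ModuleCat.hom_ext <| LinearMap.ext fun t =>
    funext fun n => by
      change SymT.map (lifting V).unop.hom n (SymT.deriv n (SymT.deriv n (t n))) =
        SymT.deriv n (t n)
      rw [unop_lifting, SymT.map_lift_deriv_deriv]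
  symmetry_rule V := Quiver.Hom.unop_inj <| ModuleCat.hom_ext <| LinearMap.ext fun t =>
    funext fun n => SymT.map_interchange_deriv_deriv (unop_interchange_apply V) n (t n)

/-- The projection onto degree one, as a `D`-linear unit. -/
noncomputable def powProj : DLinearUnit (powDeriv F) where
  app V := (ModuleCat.ofHom (Pow.proj F V.unop)).op
  naturality {V W} f := Quiver.Hom.unop_inj <| ModuleCat.hom_ext <| LinearMap.ext fun t =>
    (Pow.proj_map f.unop.hom t).symm
  linear V := Quiver.Hom.unop_inj <| ModuleCat.hom_ext <| LinearMap.ext fun v =>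
    Pow.proj_unit (F := F) (V := V.unop) v
  linearization V := Quiver.Hom.unop_inj <| ModuleCat.hom_ext <| LinearMap.ext fun t =>
    (Pow.map_snd_deriv (F := F) (V := V.unop) t).symm.trans <| by
      rw [← unop_inj₁]
      rfl

end ReducedPowerSeries

theorem corollary5p4 (F : Type u) [Field F] :
    ∃ d : CartDiff.DifferentialCombinatorTransformation (ReducedPowerSeries.powComonad F),
      (∀ V : ModuleCat.{u} F,
        d.app (Opposite.op V) = (ModuleCat.ofHom (ReducedPowerSeries.Pow.deriv F V)).op) ∧
      (∃ ε : CartDiff.DLinearUnit d, ∀ V : ModuleCat.{u} F,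
        ε.app (Opposite.op V) = (ModuleCat.ofHom (ReducedPowerSeries.Pow.proj F V)).op) ∧
      ∃ D : CartDiff.DifferentialCombinator
          (CategoryTheory.Cokleisli (ReducedPowerSeries.powComonad F)),
        (∀ (A B : CategoryTheory.Cokleisli (ReducedPowerSeries.powComonad F)) (f : A ⟶ B),
          (D.deriv f).of = d.app A.of ≫ f.of) ∧
        ∃ (Φ : (ModuleCat.{u} F)ᵒᵖ ⥤ D.Lin) (Ψ : D.Lin ⥤ (ModuleCat.{u} F)ᵒᵖ),
          Φ ⋙ CategoryTheory.wideSubcategoryInclusion D.IsLinear =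
            CategoryTheory.Cokleisli.Adjunction.toCokleisli (ReducedPowerSeries.powComonad F) ∧
          Φ ⋙ Ψ = 𝟭 (ModuleCat.{u} F)ᵒᵖ ∧ Ψ ⋙ Φ = 𝟭 D.Lin := by
  let d := ReducedPowerSeries.powDeriv F
  let ε := ReducedPowerSeries.powProj F
  exact ⟨d, fun _ => rfl, ⟨ε, fun _ => rfl⟩, d.combinator, fun _ _ _ => rfl, d.toLin, ε.ofLin, rfl,
    ε.toLin_comp_ofLin, ε.ofLin_comp_toLin⟩
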